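/- Let $F$ be an algebraically closed field of characteristic $0$, let $n\ge 3$, and let $H$ be a group. Write $H'=[H,H]$ for the derived subgroup and $Z(H)$ for the center of $H$. Let $\phi:H'\times Z(H)\to H$ be the homomorphism $\phi(h,z)=hz$, and put $\mu_n=\ker\phi$. The symbol $\equiv$ denotes elementary equivalence: in the first-order language of groups between groups, and in the first-order language of rings between fields. Then the following are equivalent: 1. $H\equiv GL_n(F)$; 2. $H\cong (H'\times Z(H))/\mu_n$, and $H'\cong SL_n(L)$ for some field $L\equiv F$, and $Z(H)\equiv\mathbb C^\times$. Moreover, if these conditions hold, then $\phi$ is a central isogeny, that is, it is surjective and its kernel $\mu_n$ is finite and central in $H'\times Z(H)$; and $\mu_n$ is isomorphic to the group of $n$-th roots of unity in $\mathbb C$. -/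

import Mathlib

open FirstOrder

universe u v

/-- The function symbols of the first-order language of groups: multiplication, inversion and the
identity. -/
inductive GroupFunc : ℕ → Type
  | mul : GroupFunc 2
  | inv : GroupFunc 1
  | one : GroupFunc 0

/-- The first-order language of groups; there are no relation symbols besides equality. -/
def groupLanguage : FirstOrder.Language where
  Functions := GroupFunc
  Relations := fun _ => Empty

/-- A group as a structure for the language of groups. -/
instance groupStructure (G : Type*) [Group G] : groupLanguage.Structure G where
  funMap := fun f x => match f with
    | GroupFunc.mul => x 0 * x 1
    | GroupFunc.inv => (x 0)⁻¹
    | GroupFunc.one => 1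
  RelMap := fun r _ => Empty.elim r

/-- `G ≡ H` for groups: the same sentences of the language of groups hold in `G` and in `H`. -/
def GroupElemEquiv (G H : Type*) [Group G] [Group H] : Prop :=
  groupLanguage.ElementarilyEquivalent G H

/-- `K ≡ L` for fields: the same sentences of the language of rings hold in `K` and in `L`. -/
def FieldElemEquiv (K L : Type*) [Field K] [Field L] : Prop :=
  letI := FirstOrder.Ring.compatibleRingOfRing K
  letI := FirstOrder.Ring.compatibleRingOfRing L
  FirstOrder.Language.ring.ElementarilyEquivalent K L

/-- The homomorphism `H' × Z(H) → H`, `(h, z) ↦ h z`, where `H' = [H, H]`. -/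
def derivedCenterHom (H : Type*) [Group H] : commutator H × Subgroup.center H →* H where
  toFun p := (p.1 : H) * (p.2 : H)
  map_one' := by simp
  map_mul' p q := by
    have h : (p.2 : H) * (q.1 : H) = (q.1 : H) * (p.2 : H) :=
      (Subgroup.mem_center_iff.mp p.2.2 (q.1 : H)).symm
    simp only [Prod.fst_mul, Prod.snd_mul, Subgroup.coe_mul]
    calc (p.1 : H) * q.1 * (p.2 * q.2) = p.1 * (q.1 * p.2) * q.2 := by simp only [mul_assoc]
      _ = p.1 * (p.2 * q.1) * q.2 := by rw [h]
      _ = p.1 * p.2 * (q.1 * q.2) := by simp only [mul_assoc]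

/-- A central isogeny of abstract groups: a surjective homomorphism whose kernel is finite and
central. -/
structure IsCentralIsogeny {A B : Type*} [Group A] [Group B] (f : A →* B) : Prop where
  surjective : Function.Surjective f
  finite_ker : Finite f.ker
  ker_le_center : f.ker ≤ Subgroup.center A

/-! Both conditions are equivalent to a structural one: `IsSLCentral n L H`, with `L` algebraically
closed of characteristic 0, together with `IsUnitsLike` for Z(H).

From the structure to GLₙ(F) (`IsSLCentral.groupElemEquiv`): `H` and GLₙ(F) have isomorphic
ultrapowers. Over a suitable regular ultrafilter the fields and centers involved all acquire the
same cardinality 2^κ. The fields are then isomorphic by Steinitz. Each center is its torsion times a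
ℚ-space, and an isomorphism of centers can be chosen to match the two images of a generator of
Z(SLₙ) (`IsUnitsLike.exists_mulEquiv`), so it glues with the identity of SLₙ.

From GLₙ(F) to the structure (`GroupElemEquiv.exists_isSLCentral`): `H` embeds elementarily into
GLₙ(K), with `K` an ultrapower of `F`, and by Tarski–Vaught every nonempty set definable over the
image meets the image. An element conjugate to its product with a central element of order `n` has
`n` distinct eigenvalues; after conjugation the image contains such an element in diagonal form, and
the diagonal torus is definable as its centralizer. Root elements are definable from the torus, and
a rescaling puts all 1 + Eᵢⱼ into the image. The commutator formula turns the coefficients occurring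
in the image into an algebraically closed field `L`. Finally, GLₙ(K) is generated by definable
pieces (torus and root subgroups), and Tarski–Vaught lets image points be factored inside the image;
hence the image lies in SLₙ(L)·Z (`IsFramed.range_le`).

Condition 2 yields the structure by perfectness of SLₙ(L), the axioms ACF₀, and the first-order
content of `IsUnitsLike`. -/

open scoped commutatorElement

/-! ### Definability with parameters, and elementary maps between groups. -/

open FirstOrder.Language in
/-- A homomorphism-free formulation of elementary embeddings: `f : H → G` preserves and reflects the
truth of all formulas with parameters in `H`. -/
def IsElementary {H G : Type*} [Group H] [Group G] (f : H → G) : Prop :=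
  ∀ φ : groupLanguage.Formula H, φ.Realize f ↔ φ.Realize id

/-- Functions given by a group word whose constants lie in the range of `f`. -/
def IsWord {H G α : Type*} [Group H] [Group G] (f : H → G) (w : (α → G) → G) : Prop :=
  ∃ t : groupLanguage.Term (H ⊕ α), ∀ v, t.realize (Sum.elim f v) = w v

/-- Predicates that are first-order definable with parameters in the range of `f`. -/
def IsDef {H G α : Type*} [Group H] [Group G] (f : H → G) (P : (α → G) → Prop) : Prop :=
  ∃ φ : groupLanguage.Formula (H ⊕ α), ∀ v, φ.Realize (Sum.elim f v) ↔ P v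

section Definability

variable {H G : Type*} [Group H] [Group G] {f : H → G} {α : Type*}

theorem IsWord.var (i : α) : IsWord f (fun v => v i) :=
  ⟨Language.Term.var (Sum.inr i), fun _ => rfl⟩

theorem IsWord.const (h : H) : IsWord f (fun _ : α → G => f h) :=
  ⟨Language.Term.var (Sum.inl h), fun _ => rfl⟩

theorem IsWord.of_mem {g : G} (hg : g ∈ Set.range f) : IsWord f (fun _ : α → G => g) := by
  obtain ⟨h, rfl⟩ := hg
  exact IsWord.const h

theorem IsWord.one : IsWord f (fun _ : α → G => 1) :=
  ⟨Language.Term.func (L := groupLanguage) GroupFunc.one Fin.elim0, fun _ => rfl⟩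

theorem IsWord.mul {a b : (α → G) → G} (ha : IsWord f a) (hb : IsWord f b) :
    IsWord f (fun v => a v * b v) := by
  obtain ⟨s, hs⟩ := ha
  obtain ⟨t, ht⟩ := hb
  refine ⟨Language.Term.func (L := groupLanguage) GroupFunc.mul ![s, t], fun v => ?_⟩
  exact congrArg₂ (· * ·) (hs v) (ht v)

theorem IsWord.inv {a : (α → G) → G} (ha : IsWord f a) : IsWord f (fun v => (a v)⁻¹) := by
  obtain ⟨s, hs⟩ := ha
  refine ⟨Language.Term.func (L := groupLanguage) GroupFunc.inv ![s], fun v => ?_⟩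
  exact congrArg (·⁻¹) (hs v)

theorem IsWord.pow {a : (α → G) → G} (ha : IsWord f a) (n : ℕ) : IsWord f (fun v => a v ^ n) := by
  induction n with
  | zero => simpa using IsWord.one
  | succ n ih => simpa only [pow_succ] using ih.mul ha

theorem IsWord.commutator {a b : (α → G) → G} (ha : IsWord f a) (hb : IsWord f b) :
    IsWord f (fun v => ⁅a v, b v⁆) := by
  simpa only [commutatorElement_def] using ((ha.mul hb).mul ha.inv).mul hb.inv

theorem IsDef.eq {a b : (α → G) → G} (ha : IsWord f a) (hb : IsWord f b) :
    IsDef f (fun v => a v = b v) := by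
  obtain ⟨s, hs⟩ := ha
  obtain ⟨t, ht⟩ := hb
  refine ⟨s.equal t, fun v => ?_⟩
  rw [Language.Formula.realize_equal, hs, ht]

theorem IsDef.false : IsDef f (fun _ : α → G => False) :=
  ⟨⊥, fun v => by simp⟩

theorem IsDef.not {P : (α → G) → Prop} (hP : IsDef f P) : IsDef f (fun v => ¬ P v) := by
  obtain ⟨φ, hφ⟩ := hP
  exact ⟨φ.not, fun v => by rw [Language.Formula.realize_not, hφ]⟩

theorem IsDef.and {P Q : (α → G) → Prop} (hP : IsDef f P) (hQ : IsDef f Q) :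
    IsDef f (fun v => P v ∧ Q v) := by
  obtain ⟨φ, hφ⟩ := hP
  obtain ⟨ψ, hψ⟩ := hQ
  exact ⟨φ ⊓ ψ, fun v => by rw [Language.Formula.realize_inf, hφ, hψ]⟩

theorem IsDef.or {P Q : (α → G) → Prop} (hP : IsDef f P) (hQ : IsDef f Q) :
    IsDef f (fun v => P v ∨ Q v) := by
  obtain ⟨φ, hφ⟩ := hP
  obtain ⟨ψ, hψ⟩ := hQ
  exact ⟨φ ⊔ ψ, fun v => by rw [Language.Formula.realize_sup, hφ, hψ]⟩

theorem IsDef.imp {P Q : (α → G) → Prop} (hP : IsDef f P) (hQ : IsDef f Q) :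
    IsDef f (fun v => P v → Q v) := by
  obtain ⟨φ, hφ⟩ := hP
  obtain ⟨ψ, hψ⟩ := hQ
  exact ⟨φ.imp ψ, fun v => by rw [Language.Formula.realize_imp, hφ, hψ]⟩

theorem IsDef.ex {P : (α → G) → G → Prop}
    (hP : IsDef f (fun w : α ⊕ Unit → G => P (fun a => w (Sum.inl a)) (w (Sum.inr ())))) :
    IsDef f (fun v => ∃ x, P v x) := by
  obtain ⟨φ, hφ⟩ := hP
  refine ⟨Language.Formula.iExs Unit (φ.relabel (Equiv.sumAssoc H α Unit).symm), fun v => ?_⟩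
  rw [Language.Formula.realize_iExs]
  simp only [Language.Formula.realize_relabel]
  constructor
  · rintro ⟨i, hi⟩
    refine ⟨i (), (hφ (Sum.elim v i)).1 ?_⟩
    convert hi using 1
    ext (_ | _ | _) <;> rfl
  · rintro ⟨x, hx⟩
    refine ⟨fun _ => x, ?_⟩
    convert (hφ (Sum.elim v fun _ => x)).2 hx using 1
    ext (_ | _ | _) <;> rfl

theorem IsDef.all {P : (α → G) → G → Prop}
    (hP : IsDef f (fun w : α ⊕ Unit → G => P (fun a => w (Sum.inl a)) (w (Sum.inr ())))) :
    IsDef f (fun v => ∀ x, P v x) := by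
  simpa only [not_exists, not_not] using (IsDef.ex (P := fun v x => ¬ P v x) hP.not).not

theorem IsDef.exists_finset {ι : Type*} (s : Finset ι) {P : ι → (α → G) → Prop}
    (hP : ∀ i ∈ s, IsDef f (P i)) : IsDef f (fun v => ∃ i ∈ s, P i v) := by
  classical
  induction s using Finset.induction with
  | empty => simpa using IsDef.false
  | insert a s has ih =>
    simpa only [Finset.exists_mem_insert] using
      (hP a (Finset.mem_insert_self a s)).or
        (ih fun i hi => hP i (Finset.mem_insert_of_mem hi))

theorem IsDef.forall_finset {ι : Type*} (s : Finset ι) {P : ι → (α → G) → Prop}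
    (hP : ∀ i ∈ s, IsDef f (P i)) : IsDef f (fun v => ∀ i ∈ s, P i v) := by
  simpa only [not_exists, not_and, not_not] using
    (IsDef.exists_finset s (P := fun i v => ¬ P i v) fun i hi => (hP i hi).not).not

/-- Sets that are definable with parameters in the range of `f`. -/
def IsDefSet (f : H → G) (S : Set G) : Prop :=
  IsDef f (fun v : Unit → G => v () ∈ S)

theorem IsDefSet.mem {S : Set G} (hS : IsDefSet f S) {a : (α → G) → G} (ha : IsWord f a) :
    IsDef f (fun v => a v ∈ S) := by
  obtain ⟨φ, hφ⟩ := hS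
  obtain ⟨t, ht⟩ := ha
  refine ⟨φ.subst (Sum.elim (fun h => Language.Term.var (Sum.inl h)) fun _ => t), fun v => ?_⟩
  simp only [← ht v]
  refine Iff.trans ?_ (hφ fun _ => t.realize (Sum.elim f v))
  refine Language.BoundedFormula.realize_subst.trans ?_
  refine iff_of_eq (congrArg φ.Realize (funext fun a => ?_))
  rcases a with _ | _ <;> rfl

/-- This is the product set `S * T`; writing the second factor as `s⁻¹ * g` leaves a single
quantifier. -/
theorem IsDefSet.mul {S T : Set G} (hS : IsDefSet f S) (hT : IsDefSet f T) :
    IsDefSet f {g | ∃ s, s ∈ S ∧ s⁻¹ * g ∈ T} :=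
  IsDef.ex ((hS.mem (IsWord.var _)).and (hT.mem ((IsWord.var _).inv.mul (IsWord.var _))))

namespace IsElementary

/-- The Tarski–Vaught criterion. -/
theorem exists_mem (hf : IsElementary f) {S : Set G} (hS : IsDefSet f S) (hne : S.Nonempty) :
    ∃ h, f h ∈ S := by
  obtain ⟨φ, hφ⟩ := hS
  have h₁ : (Language.Formula.iExs Unit φ).Realize f := by
    rw [Language.Formula.realize_iExs]
    obtain ⟨g, hg⟩ := hne
    exact ⟨fun _ => g, (hφ fun _ => g).2 hg⟩
  rw [hf, Language.Formula.realize_iExs] at h₁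
  obtain ⟨i, hi⟩ := h₁
  refine ⟨i (), (hφ fun _ => f (i ())).1 ?_⟩
  -- The witness found in `H` becomes a parameter, so elementarity applies again and carries it back
  -- to `G`.
  have h₂ := (hf (φ.relabel (Sum.elim id i)))
  rw [Language.Formula.realize_relabel, Language.Formula.realize_relabel] at h₂
  have h₃ := h₂.2 (by convert hi using 1; ext (_ | _) <;> rfl)
  convert h₃ using 1
  ext (_ | _) <;> rfl

theorem exists_mem_of_mem_mul (hf : IsElementary f) {S T : Set G} (hS : IsDefSet f S)
    (hT : IsDefSet f T) {h : H} {s t : G} (hs : s ∈ S) (ht : t ∈ T) (hst : f h = s * t) :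
    ∃ a, f a ∈ S ∧ (f a)⁻¹ * f h ∈ T :=
  hf.exists_mem (S := {x | x ∈ S ∧ x⁻¹ * f h ∈ T})
    ((hS.mem (IsWord.var _)).and (hT.mem ((IsWord.var _).inv.mul (IsWord.const _))))
    ⟨s, hs, by simpa [hst] using ht⟩

theorem map_mul (hf : IsElementary f) (a b : H) : f (a * b) = f a * f b := by
  let t : groupLanguage.Term H :=
    Language.Term.func (L := groupLanguage) GroupFunc.mul
      ![Language.Term.var a, Language.Term.var b]
  have h := hf ((Language.Term.var (a * b)).equal t)
  rw [Language.Formula.realize_equal, Language.Formula.realize_equal] at h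
  exact h.2 rfl

theorem injective (hf : IsElementary f) : Function.Injective f := fun a b hab => by
  have h := hf ((Language.Term.var a).equal (Language.Term.var b))
  rw [Language.Formula.realize_equal, Language.Formula.realize_equal] at h
  exact h.1 hab

/-- The group homomorphism underlying an elementary map. -/
def hom (hf : IsElementary f) : H →* G := MonoidHom.mk' f hf.map_mul

@[simp] theorem hom_apply (hf : IsElementary f) (h : H) : hf.hom h = f h := rfl

theorem map_one (hf : IsElementary f) : f 1 = 1 := hf.hom.map_one

theorem map_inv (hf : IsElementary f) (a : H) : f a⁻¹ = (f a)⁻¹ := hf.hom.map_inv a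

theorem map_pow (hf : IsElementary f) (a : H) (k : ℕ) : f (a ^ k) = f a ^ k := hf.hom.map_pow a k

theorem mem_center_iff (hf : IsElementary f) {h : H} :
    f h ∈ Subgroup.center G ↔ h ∈ Subgroup.center H := by
  constructor
  · intro hh
    rw [Subgroup.mem_center_iff] at hh ⊢
    intro g
    exact hf.injective (by rw [hf.map_mul, hf.map_mul, hh])
  · intro hh
    by_contra hc
    rw [Subgroup.mem_center_iff] at hh hc
    push Not at hc
    -- Failure to commute with `f h` is a definable condition, so it is already witnessed in the
    -- image.
    obtain ⟨g, hg⟩ := hf.exists_mem (S := {g | ¬ g * f h = f h * g})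
      (IsDef.not (IsDef.eq ((IsWord.var _).mul (IsWord.const _))
        ((IsWord.const _).mul (IsWord.var _)))) hc
    exact hg (by rw [← hf.map_mul, ← hf.map_mul, hh])

end IsElementary

/-- A group isomorphism as an isomorphism of structures. -/
def MulEquiv.toGroupLanguageEquiv {A B : Type*} [Group A] [Group B] (e : A ≃* B) :
    A ≃[groupLanguage] B where
  toEquiv := e.toEquiv
  map_fun' := by
    intro n s x
    cases s with
    | mul => exact e.map_mul _ _
    | inv => exact e.map_inv _
    | one => exact e.map_one
  map_rel' := by
    intro n r
    exact Empty.elim r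

theorem GroupElemEquiv.of_mulEquiv {A B : Type*} [Group A] [Group B] (e : A ≃* B) :
    GroupElemEquiv A B :=
  e.toGroupLanguageEquiv.toElementaryEmbedding.elementarilyEquivalent

theorem IsElementary.comp_mulEquiv {K : Type*} [Group K] (hf : IsElementary f) (e : G ≃* K) :
    IsElementary (fun h => e (f h)) := fun φ => by
  rw [← hf φ]
  exact Language.StrongHomClass.realize_formula e.toGroupLanguageEquiv φ

theorem isDefSet_center : IsDefSet f (Subgroup.center G : Set G) := by
  have h : IsDef f (fun v : Unit → G => ∀ g, g * v () = v () * g) :=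
    IsDef.all (IsDef.eq ((IsWord.var _).mul (IsWord.var _)) ((IsWord.var _).mul (IsWord.var _)))
  simpa only [IsDefSet, SetLike.mem_coe, Subgroup.mem_center_iff] using h

end Definability

/-! ### Ultrapowers as groups of germs, and elementary maps into them. -/

section Ultrapower

open Filter

variable {I : Type*} {U : Ultrafilter I} {G : Type*} [Group G]

/-- The ultraproduct of a constant family is the group of germs. -/
def productEquivGerm : (U : Filter I).Product (fun _ => G) ≃[groupLanguage] Germ (U : Filter I) G where
  toEquiv := Equiv.refl _
  map_fun' := by
    intro n s x
    obtain ⟨y, rfl⟩ : ∃ y : Fin n → I → G,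
        x = fun i => ((y i : I → G) : (U : Filter I).Product fun _ => G) :=
      ⟨fun i => (x i).out, funext fun i => (Quotient.out_eq _).symm⟩
    refine (congrArg (Equiv.refl _) (Language.Ultraproduct.funMap_cast s y)).trans ?_
    cases s <;> rfl
  map_rel' := by
    intro n r
    exact Empty.elim r

theorem Filter.Germ.realize_formula {α : Type*} (φ : groupLanguage.Formula α) (x : α → I → G) :
    φ.Realize (fun a => (x a : Germ (U : Filter I) G)) ↔ ∀ᶠ i in U, φ.Realize fun a => x a i := by
  rw [← Language.Ultraproduct.realize_formula_cast (M := fun _ => G)]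
  exact Language.StrongHomClass.realize_formula productEquivGerm φ

theorem Filter.Germ.groupElemEquiv : GroupElemEquiv G (Germ (U : Filter I) G) := by
  rw [GroupElemEquiv, Language.elementarilyEquivalent_iff]
  intro φ
  have h := Filter.Germ.realize_formula (U := U) (G := G) φ fun e => Empty.elim e
  have e₁ : (fun a => ((fun e => Empty.elim e : Empty → I → G) a : Germ (U : Filter I) G)) =
      default := Subsingleton.elim _ _
  have e₂ : ∀ i, (fun a => (fun e => Empty.elim e : Empty → I → G) a i) = default :=
    fun i => Subsingleton.elim _ _
  simp only [e₁, e₂, Filter.eventually_const] at h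
  exact h.symm

/-- Only finitely many elements of `H` occur in `φ`; quantifying them existentially gives a
sentence, which transfers. -/
theorem GroupElemEquiv.exists_realize {H : Type*} [Group H] (h : GroupElemEquiv H G)
    (φ : groupLanguage.Formula H) (hφ : φ.Realize id) : ∃ c : H → G, φ.Realize c := by
  classical
  have h₁ : H ⊨ φ.exClosure := (Language.Formula.realize_exClosure φ).2
    ⟨fun a => a, (Language.BoundedFormula.realize_restrictFreeVar (φ := φ) (f := id)
      (v := fun a => (a : H))
      (v' := id) fun _ => rfl).2 hφ⟩
  rw [h.realize_sentence] at h₁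
  obtain ⟨c, hc⟩ := (Language.Formula.realize_exClosure φ).1 h₁
  -- Parameters not occurring in `φ` get the dummy value `1`.
  refine ⟨fun a => if ha : a ∈ φ.freeVarFinset then c ⟨a, ha⟩ else 1,
    (Language.BoundedFormula.realize_restrictFreeVar _ fun a => ?_).1 hc⟩
  simp

/-- Compactness: each finite set of formulas true in `H` is satisfied by some assignment in `G`, and
the germ of these assignments satisfies all of them by Łoś. Reflection of truth follows by negation.
-/
theorem GroupElemEquiv.exists_isElementary {H : Type u} [Group H] {G : Type v} [Group G]
    (h : GroupElemEquiv H G) : ∃ (I : Type u) (U : Ultrafilter I)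
      (f : H → Germ (U : Filter I) G), IsElementary f := by
  classical
  let J := {φ : groupLanguage.Formula H // φ.Realize id}
  have hc : ∀ s : Finset J, ∃ c : H → G, ∀ φ ∈ s, φ.1.Realize c := by
    intro s
    obtain ⟨c, hc⟩ := h.exists_realize (Language.Formula.iInf (fun φ : s => φ.1.1)) (by
      rw [Language.Formula.realize_iInf]
      exact fun φ => φ.1.2)
    rw [Language.Formula.realize_iInf] at hc
    exact ⟨c, fun φ hφ => hc ⟨φ, hφ⟩⟩
  choose c hc using hc
  let U : Ultrafilter (Finset J) := Ultrafilter.of atTop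
  have key : ∀ φ : groupLanguage.Formula H, φ.Realize id →
      φ.Realize (fun h => ((fun s => c s h : Finset J → G) : Germ (U : Filter (Finset J)) G)) := by
    intro φ hφ
    rw [Filter.Germ.realize_formula]
    have h₁ : ∀ᶠ s : Finset J in atTop, (⟨φ, hφ⟩ : J) ∈ s :=
      (eventually_ge_atTop {⟨φ, hφ⟩}).mono fun s hs => hs (Finset.mem_singleton_self _)
    have h₂ : ∀ᶠ s in (U : Filter (Finset J)), (⟨φ, hφ⟩ : J) ∈ s := Ultrafilter.of_le atTop h₁
    exact h₂.mono fun s hs => hc s _ hs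
  refine ⟨Finset J, U, _, fun φ => ⟨fun hφ => ?_, key φ⟩⟩
  by_contra hn
  have h₁ := key φ.not (by rwa [Language.Formula.realize_not])
  rw [Language.Formula.realize_not] at h₁
  exact h₁ hφ

end Ultrapower

/-! ### Ultrapowers of matrix groups and of algebraically closed fields. -/

theorem MonoidHom.nonempty_mulEquiv_of_ker_eq {A B C : Type*} [Group A] [Group B] [Group C]
    {f : A →* B} {g : A →* C} (hf : Function.Surjective f) (hg : Function.Surjective g)
    (h : f.ker = g.ker) : Nonempty (B ≃* C) :=
  ⟨((QuotientGroup.quotientKerEquivOfSurjective f hf).symm.trans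
    (QuotientGroup.quotientMulEquivOfEq h)).trans (QuotientGroup.quotientKerEquivOfSurjective g hg)⟩

section GermMatrix

open Filter Matrix

variable {I : Type*} {U : Ultrafilter I} {F : Type*} [Field F] {n : Type*} [Fintype n]
  [DecidableEq n]

theorem Filter.Germ.nonempty_mulEquiv {G X : Type*} [Group G] [Group X] {ψ : (I → G) →* X}
    (hs : Function.Surjective ψ) (hk : ∀ x, ψ x = 1 ↔ ∀ᶠ i in U, x i = 1) :
    Nonempty (Germ (U : Filter I) G ≃* X) := by
  refine MonoidHom.nonempty_mulEquiv_of_ker_eq (f := Germ.coeMulHom (U : Filter I)) (g := ψ)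
    Quotient.mk_surjective hs ?_
  ext x
  rw [MonoidHom.mem_ker, MonoidHom.mem_ker, hk]
  exact Germ.coe_eq

/-- The matrix of germs attached to a family of matrices. -/
def germMatrix (U : Ultrafilter I) : (I → Matrix n n F) →* Matrix n n (Germ (U : Filter I) F) where
  toFun M := Matrix.of fun a b => ((fun i => M i a b : I → F) : Germ (U : Filter I) F)
  map_one' := by
    ext a b
    by_cases h : a = b
    · subst h; simp; rfl
    · simp [h]; rfl
  map_mul' M N := by
    ext a b
    simp only [Matrix.of_apply, Matrix.mul_apply]
    refine Eq.trans ?_ (map_sum (Germ.coeRingHom (U : Filter I)) (fun c i => M i a c * N i c b) _)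
    refine congrArg _ (funext fun i => ?_)
    simp [Matrix.mul_apply]

theorem germMatrix_eq_one {M : I → Matrix n n F} : germMatrix U M = 1 ↔ ∀ᶠ i in U, M i = 1 := by
  rw [← (germMatrix U).map_one]
  constructor
  · intro h
    have h₁ : ∀ a b, ∀ᶠ i in U, M i a b = (1 : Matrix n n F) a b := fun a b =>
      Germ.coe_eq.1 (congrFun (congrFun h a) b)
    have h₂ : ∀ᶠ i in U, ∀ a b, M i a b = (1 : Matrix n n F) a b := by
      rw [eventually_all]; intro a; rw [eventually_all]; exact h₁ a
    exact h₂.mono fun i hi => by ext a b; exact hi a b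
  · intro h
    ext a b
    exact Germ.coe_eq.2 (h.mono fun i hi => by simp [hi])

theorem exists_germMatrix_eq (A : Matrix n n (Germ (U : Filter I) F)) :
    ∃ M : I → Matrix n n F, germMatrix U M = A :=
  ⟨fun i a b => (A a b).out i, by ext a b; exact Quotient.out_eq _⟩

theorem det_germMatrix (M : I → Matrix n n F) :
    (germMatrix U M).det = ((fun i => (M i).det : I → F) : Germ (U : Filter I) F) := by
  have h : germMatrix U M =
      (Germ.coeRingHom (U : Filter I)).mapMatrix (Matrix.of fun a b i => M i a b) := rfl
  rw [h, ← RingHom.map_det]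
  refine congrArg _ (funext fun i => ?_)
  exact RingHom.map_det (Pi.evalRingHom (fun _ : I => F) i) _

theorem germMatrix_congr {M N : I → Matrix n n F} (h : ∀ᶠ i in U, M i = N i) :
    germMatrix U M = germMatrix U N := by
  ext a b
  exact Germ.coe_eq.2 (h.mono fun i hi => by simp [hi])

theorem nonempty_germ_specialLinearGroup_mulEquiv :
    Nonempty (Germ (U : Filter I) (SpecialLinearGroup n F) ≃*
      SpecialLinearGroup n (Germ (U : Filter I) F)) := by
  let ψ : (I → SpecialLinearGroup n F) →* SpecialLinearGroup n (Germ (U : Filter I) F) :=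
    { toFun := fun x => ⟨germMatrix U fun i => (x i : Matrix n n F), by
        rw [det_germMatrix]; exact congrArg _ (funext fun i => (x i).2)⟩
      map_one' := Subtype.ext (germMatrix U).map_one
      map_mul' := fun x y => Subtype.ext ((germMatrix U).map_mul _ _) }
  refine Filter.Germ.nonempty_mulEquiv (ψ := ψ) (fun A => ?_) fun x => ?_
  · obtain ⟨M, hM⟩ := exists_germMatrix_eq (A : Matrix n n (Germ (U : Filter I) F))
    have hd : ∀ᶠ i in U, (M i).det = 1 := by
      have h := A.2
      rw [← hM, det_germMatrix] at h
      exact Germ.coe_eq.1 h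
    classical
    -- Off the large set where the determinant is `1` the value is irrelevant.
    refine ⟨fun i => if h : (M i).det = 1 then ⟨M i, h⟩ else 1, Subtype.ext ?_⟩
    refine Eq.trans (germMatrix_congr (hd.mono fun i hi => ?_)) hM
    simp [hi]
  · refine Subtype.ext_iff.trans (germMatrix_eq_one.trans ?_)
    refine eventually_congr (Eventually.of_forall fun i => ?_)
    exact ⟨fun h => Subtype.ext h, fun h => congrArg Subtype.val h⟩

theorem nonempty_germ_generalLinearGroup_mulEquiv :
    Nonempty (Germ (U : Filter I) (GeneralLinearGroup n F) ≃*
      GeneralLinearGroup n (Germ (U : Filter I) F)) := by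
  let ψ : (I → GeneralLinearGroup n F) →* GeneralLinearGroup n (Germ (U : Filter I) F) :=
    (Units.map (germMatrix U)).comp
      (MulEquiv.piUnits (M := fun _ : I => Matrix n n F)).symm.toMonoidHom
  have hψ : ∀ x, (ψ x).1 = germMatrix U fun i => (x i).1 := fun x => rfl
  refine Filter.Germ.nonempty_mulEquiv (ψ := ψ) (fun A => ?_) fun x => ?_
  · obtain ⟨M, hM⟩ := exists_germMatrix_eq A.1
    have hd : ∀ᶠ i in U, (M i).det ≠ 0 := by
      by_contra h
      rw [← Ultrafilter.eventually_not] at h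
      simp only [not_not] at h
      have h₁ : A.1.det = 0 := by
        rw [← hM, det_germMatrix]
        exact Germ.coe_eq.2 h
      exact ((Matrix.isUnit_iff_isUnit_det _).1 A.isUnit).ne_zero h₁
    classical
    refine ⟨fun i => if h : (M i).det ≠ 0 then GeneralLinearGroup.mkOfDetNeZero (M i) h else 1,
      Units.ext ?_⟩
    rw [hψ]
    refine Eq.trans (germMatrix_congr (hd.mono fun i hi => ?_)) hM
    simp [hi, GeneralLinearGroup.mkOfDetNeZero]
  · rw [Units.ext_iff, hψ, Units.val_one, germMatrix_eq_one]
    refine eventually_congr (Eventually.of_forall fun i => ?_)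
    exact (Units.ext_iff (u := x i) (v := 1)).symm

/-- A monic lift of `p` to the product ring keeps its degree in every coordinate; roots chosen
coordinatewise have a root of `p` as germ. -/
instance Filter.Germ.instIsAlgClosed [IsAlgClosed F] : IsAlgClosed (Germ (U : Filter I) F) := by
  refine IsAlgClosed.of_exists_root _ fun p hp hirr => ?_
  have hl : p ∈ Polynomial.lifts (Germ.coeRingHom (U : Filter I) (R := F)) :=
    (Polynomial.lifts_iff_coeff_lifts _).2 fun k => Quotient.mk_surjective (p.coeff k)
  obtain ⟨q, hq, hdeg, hmonic⟩ := Polynomial.lifts_and_natDegree_eq_and_monic hl hp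
  have hr : ∀ i, ∃ r, (q.map (Pi.evalRingHom (fun _ : I => F) i)).eval r = 0 := fun i => by
    refine IsAlgClosed.exists_root _ ?_
    rw [Polynomial.degree_eq_natDegree (hmonic.map _).ne_zero, hmonic.natDegree_map, hdeg]
    exact_mod_cast hirr.natDegree_pos.ne'
  choose r hr using hr
  have h₀ : q.eval r = 0 := by
    funext i
    refine Eq.trans ?_ (hr i)
    rw [Polynomial.eval_map]
    exact (Polynomial.eval₂_at_apply (Pi.evalRingHom (fun _ : I => F) i) r).symm
  refine ⟨Germ.coeRingHom (U : Filter I) r, ?_⟩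
  rw [← hq, Polynomial.eval_map, Polynomial.eval₂_at_apply, h₀, map_zero]

instance Filter.Germ.instCharZero [CharZero F] : CharZero (Germ (U : Filter I) F) :=
  charZero_of_injective_ringHom
    ((Germ.coeRingHom (U : Filter I)).comp (Pi.constRingHom I F)).injective

end GermMatrix

/-! ### Cardinality of regular ultrapowers. -/

section Regular

open Filter

/-- A regular ultrafilter on the finite subsets of `κ`. -/
noncomputable def regularUltrafilter (κ : Type*) : Ultrafilter (Finset κ) := Ultrafilter.of atTop

theorem eventually_mem_regularUltrafilter {κ : Type*} (k : κ) :
    ∀ᶠ s in (regularUltrafilter κ : Filter (Finset κ)), k ∈ s :=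
  Ultrafilter.of_le atTop
    ((eventually_ge_atTop {k}).mono fun _ hs => hs (Finset.mem_singleton_self k))

/-- The upper bound is |A|^|Finset κ| ≤ (2^κ)^κ = 2^κ. For the lower bound, `f : κ → Bool` is sent
to the germ of codes in `A` of its restrictions to finite sets; regularity lets the germ recover `f
k` for every `k`. -/
theorem nonempty_germ_equiv {κ A : Type*} [Infinite κ] [Infinite A] (g : A ↪ (κ → Bool)) :
    Nonempty (Germ (regularUltrafilter κ : Filter (Finset κ)) A ≃ (κ → Bool)) := by
  classical
  have hup : Nonempty (Germ (regularUltrafilter κ : Filter (Finset κ)) A ↪ (κ → Bool)) := by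
    have e₁ : Nonempty (Finset κ × κ ≃ κ) := by
      rw [← Cardinal.eq, Cardinal.mk_prod, Cardinal.lift_id, Cardinal.lift_id,
        Cardinal.mk_finset_of_infinite, Cardinal.mul_eq_self (Cardinal.aleph0_le_mk κ)]
    obtain ⟨e₁⟩ := e₁
    refine ⟨(Function.Embedding.mk Quotient.out Quotient.out_injective).trans
      (((Function.Embedding.arrowCongrRight g).trans
        (Equiv.curry (Finset κ) κ Bool).symm.toEmbedding).trans
        (Equiv.arrowCongr e₁ (Equiv.refl Bool)).toEmbedding)⟩
  have hlow : Nonempty ((κ → Bool) ↪ Germ (regularUltrafilter κ : Filter (Finset κ)) A) := by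
    let c : ∀ s : Finset κ, (s → Bool) ↪ A := fun s =>
      ((Fintype.equivFin (s → Bool)).toEmbedding.trans Fin.valEmbedding).trans
        (Infinite.natEmbedding A)
    refine ⟨⟨fun f => ((fun s => c s fun k => f k : Finset κ → A) : Germ _ A), fun f g hfg => ?_⟩⟩
    have h := Germ.coe_eq.1 hfg
    funext k
    obtain ⟨s, hs, hk⟩ := (h.and (eventually_mem_regularUltrafilter k)).exists
    exact congrFun ((c s).injective hs) ⟨k, hk⟩
  obtain ⟨a⟩ := hup
  obtain ⟨b⟩ := hlow
  exact Function.Embedding.antisymm a b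

theorem aleph0_lt_of_equiv {κ : Type u} [Infinite κ] {A : Type v} (e : A ≃ (κ → Bool)) :
    Cardinal.aleph0 < Cardinal.mk A := by
  have h := Cardinal.lift_mk_eq'.2 ⟨e⟩
  have h₂ : Cardinal.aleph0 < Cardinal.mk (κ → Bool) := by
    simpa using (Cardinal.aleph0_le_mk κ).trans_lt (Cardinal.cantor _)
  rw [← Cardinal.aleph0_lt_lift.{v, u}, h, Cardinal.aleph0_lt_lift]
  exact h₂

end Regular

/-! ### Splitting and extension of isomorphisms for divisible abelian groups. -/

section Divisible

open Cardinal

/-- The torsion subgroup inherits divisibility, so it is injective by Baer's criterion and its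
identity map extends to `A`. -/
theorem AddCommGroup.exists_torsion_retraction {A : Type*} [AddCommGroup A]
    (hA : ∀ m : ℕ, m ≠ 0 → ∀ x : A, ∃ y, m • y = x) :
    ∃ r : A →+ AddCommGroup.torsion A, ∀ x : AddCommGroup.torsion A, r x = x := by
  have hdiv : ∀ {m : ℤ}, m ≠ 0 →
      Function.Surjective (fun x : AddCommGroup.torsion A => m • x) := by
    intro m hm x
    obtain ⟨y, hy⟩ := hA m.natAbs (Int.natAbs_ne_zero.2 hm) x
    have hy' : y ∈ AddCommGroup.torsion A := by
      obtain ⟨k, hk, hkx⟩ := isOfFinAddOrder_iff_nsmul_eq_zero.1 x.2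
      exact isOfFinAddOrder_iff_nsmul_eq_zero.2
        ⟨k * m.natAbs, Nat.mul_pos hk (Int.natAbs_pos.2 hm), by rw [mul_nsmul', hy, hkx]⟩
    rcases Int.natAbs_eq m with h | h
    · exact ⟨⟨y, hy'⟩, Subtype.ext (by
        change m • y = x
        rw [h, natCast_zsmul, hy])⟩
    · exact ⟨⟨-y, neg_mem hy'⟩, Subtype.ext (by
        change m • -y = x
        rw [h, neg_smul, smul_neg, neg_neg, natCast_zsmul, hy])⟩
  let : DivisibleBy (AddCommGroup.torsion A) ℤ := divisibleByOfSMulRightSurj _ _ hdiv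
  obtain ⟨r, hr⟩ := (Module.Baer.of_divisible (AddCommGroup.torsion A)).extension_property_addMonoidHom
    (AddCommGroup.torsion A).subtype Subtype.val_injective (AddMonoidHom.id _)
  exact ⟨r, fun x => DFunLike.congr_fun hr x⟩

/-- For divisible `A` the map to `DivisibleHull A` is onto with kernel the torsion, so the hull
serves as the torsion-free quotient. -/
theorem AddCommGroup.exists_torsion_prod_equiv {A : Type*} [AddCommGroup A]
    (hA : ∀ m : ℕ, m ≠ 0 → ∀ x : A, ∃ y, m • y = x) :
    ∃ e : A ≃+ AddCommGroup.torsion A × DivisibleHull A,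
      ∀ x : AddCommGroup.torsion A, e x = (x, 0) := by
  obtain ⟨r, hr⟩ := AddCommGroup.exists_torsion_retraction hA
  have hker : ∀ x : A, DivisibleHull.coeAddMonoidHom A x = 0 ↔ x ∈ AddCommGroup.torsion A := by
    intro x
    have h0 : (0 : DivisibleHull A) = DivisibleHull.mk 0 1 := (DivisibleHull.mk_zero 1).symm
    rw [DivisibleHull.coeAddMonoidHom_apply, h0, DivisibleHull.mk_eq_mk]
    constructor
    · rintro ⟨k, hk⟩
      exact isOfFinAddOrder_iff_nsmul_eq_zero.2 ⟨k, k.2, by simpa using hk⟩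
    · intro h
      obtain ⟨k, hk, hkx⟩ := isOfFinAddOrder_iff_nsmul_eq_zero.1 h
      exact ⟨⟨k, hk⟩, by simpa using hkx⟩
  let g : A →+ AddCommGroup.torsion A × DivisibleHull A :=
    r.prod (DivisibleHull.coeAddMonoidHom A)
  have hg : ∀ x : AddCommGroup.torsion A, g x = (x, 0) := fun x =>
    Prod.ext (hr x) ((hker x).2 x.2)
  refine ⟨AddEquiv.ofBijective g ⟨?_, ?_⟩, hg⟩
  · rw [injective_iff_map_eq_zero]
    intro x hx
    have h₁ := hg ⟨x, (hker x).1 (congrArg Prod.snd hx)⟩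
    have h₂ := congrArg Prod.fst (h₁.symm.trans hx)
    exact congrArg Subtype.val h₂
  · rintro ⟨t, q⟩
    obtain ⟨y, rfl⟩ : ∃ y, DivisibleHull.coeAddMonoidHom A y = q := by
      induction q with
      | mk m s =>
        obtain ⟨y, hy⟩ := hA s s.pos.ne' m
        refine ⟨y, ?_⟩
        rw [DivisibleHull.coeAddMonoidHom_apply, DivisibleHull.mk_eq_mk]
        exact ⟨1, by simp [hy]⟩
    refine ⟨y + (t - r y : AddCommGroup.torsion A), ?_⟩
    rw [map_add, hg]
    exact Prod.ext (by simp [g]) (by simp [g])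

theorem AddCommGroup.mk_divisibleHull {C : Type*} [AddCommGroup C]
    (hC : ∀ m : ℕ, m ≠ 0 → ∀ x : C, ∃ y, m • y = x) (hunc : ℵ₀ < #C)
    [Countable (AddCommGroup.torsion C)] : #(DivisibleHull C) = #C := by
  obtain ⟨e, -⟩ := AddCommGroup.exists_torsion_prod_equiv hC
  have h₁ : #C = #(AddCommGroup.torsion C) * #(DivisibleHull C) := by
    rw [Cardinal.mul_def]; exact Cardinal.mk_congr e.toEquiv
  have h₂ : #(AddCommGroup.torsion C) ≤ ℵ₀ := Cardinal.mk_le_aleph0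
  have h₃ : ℵ₀ < #(DivisibleHull C) := by
    by_contra h
    exact absurd (h₁ ▸ hunc) (not_lt.2 ((mul_le_mul' h₂ (not_lt.1 h)).trans (by simp)))
  rw [h₁, Cardinal.mul_eq_right h₃.le (h₂.trans h₃.le) (Cardinal.mk_ne_zero _)]

/-- The torsion-free parts are ℚ-spaces of equal uncountable cardinality, hence of equal dimension.
-/
theorem AddCommGroup.exists_addEquiv_extending {A : Type u} {B : Type v} [AddCommGroup A]
    [AddCommGroup B] (hA : ∀ m : ℕ, m ≠ 0 → ∀ x : A, ∃ y, m • y = x)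
    (hB : ∀ m : ℕ, m ≠ 0 → ∀ x : B, ∃ y, m • y = x) (hAB : Nonempty (A ≃ B)) (hunc : ℵ₀ < #A)
    [Countable (AddCommGroup.torsion A)] (θ : AddCommGroup.torsion A ≃+ AddCommGroup.torsion B) :
    ∃ τ : A ≃+ B, ∀ x : AddCommGroup.torsion A, τ x = θ x := by
  have hcB : Countable (AddCommGroup.torsion B) := θ.symm.injective.countable
  have hl : lift.{v} #A = lift.{u} #B := Cardinal.lift_mk_eq'.2 hAB
  have huncB : ℵ₀ < #B := by
    rw [← Cardinal.aleph0_lt_lift.{v, u}, ← hl, Cardinal.aleph0_lt_lift]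
    exact hunc
  have hDA := AddCommGroup.mk_divisibleHull hA hunc
  have hDB := AddCommGroup.mk_divisibleHull hB huncB
  obtain ⟨ε⟩ : Nonempty (DivisibleHull A ≃ₗ[ℚ] DivisibleHull B) :=
    nonempty_linearEquiv_of_lift_rank_eq (by
      rw [Module.Free.rank_eq_mk_of_infinite_lt ℚ (DivisibleHull A) (by simpa [hDA] using hunc),
        Module.Free.rank_eq_mk_of_infinite_lt ℚ (DivisibleHull B) (by simpa [hDB] using huncB),
        hDA, hDB, hl])
  obtain ⟨e, he⟩ := AddCommGroup.exists_torsion_prod_equiv hA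
  obtain ⟨e', he'⟩ := AddCommGroup.exists_torsion_prod_equiv hB
  refine ⟨(e.trans (AddEquiv.prodCongr θ ε.toAddEquiv)).trans e'.symm, fun x => ?_⟩
  have h : e x = (x, 0) := he x
  rw [AddEquiv.trans_apply, AddEquiv.trans_apply, h, AddEquiv.symm_apply_eq, he']
  exact Prod.ext rfl (map_zero ε)

end Divisible

/-! ### Groups resembling the units of an algebraically closed field of characteristic 0. -/

/-- Divisible (abelian) groups in which, for each `m`, the `m`-torsion is cyclic of order `m`. -/
structure IsUnitsLike (A : Type*) [Group A] : Prop where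
  exists_pow : ∀ m : ℕ, m ≠ 0 → ∀ x : A, ∃ y, y ^ m = x
  exists_generator : ∀ m : ℕ, m ≠ 0 → ∃ c : A, orderOf c = m ∧
    ∀ x : A, x ^ m = 1 → x ∈ Subgroup.zpowers c

namespace IsUnitsLike

variable {A B : Type*} [CommGroup A] [CommGroup B]

/-- By counting, any element of order `m` generates the same subgroup as the one provided by
`exists_generator`. -/
theorem mem_zpowers (hA : IsUnitsLike A) {c x : A} {m : ℕ} (hm : m ≠ 0) (hc : orderOf c = m)
    (hx : x ^ m = 1) : x ∈ Subgroup.zpowers c := by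
  obtain ⟨g, hg, hgen⟩ := hA.exists_generator m hm
  have hfin : Finite (Subgroup.zpowers g) := by
    rw [← Nat.card_zpowers] at hg
    exact Nat.finite_of_card_ne_zero (hg ▸ hm)
  have hle : Subgroup.zpowers c ≤ Subgroup.zpowers g :=
    (Subgroup.zpowers_le).2 (hgen c (hc ▸ pow_orderOf_eq_one c))
  have h : Subgroup.zpowers c = Subgroup.zpowers g :=
    SetLike.coe_injective (Set.eq_of_subset_of_ncard_le hle
      (by
        change Nat.card (Subgroup.zpowers g) ≤ Nat.card (Subgroup.zpowers c)
        rw [Nat.card_zpowers, Nat.card_zpowers, hc, hg]) (Set.toFinite _))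
  rw [h]
  exact hgen x hx

theorem exists_pow_eq_orderOf (hA : IsUnitsLike A) {a : A} {N k : ℕ} (hN : N ≠ 0) (hk : k ≠ 0)
    (ha : orderOf a = N) : ∃ a' : A, a' ^ k = a ∧ orderOf a' = N * k := by
  have hNk : N * k ≠ 0 := Nat.mul_ne_zero hN hk
  obtain ⟨c, hc, hgen⟩ := hA.exists_generator (N * k) hNk
  have hca : a ∈ Subgroup.zpowers c := hgen a (by rw [pow_mul, ← ha, pow_orderOf_eq_one, one_pow])
  have hfo : IsOfFinOrder c := orderOf_pos_iff.1 (by omega)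
  obtain ⟨j, rfl⟩ := hfo.mem_powers_iff_mem_zpowers.2 hca
  simp only at ha ⊢
  rw [hfo.orderOf_pow, hc] at ha
  have hg : (N * k).gcd j = k := by
    have h₁ := Nat.div_mul_cancel (Nat.gcd_dvd_left (N * k) j)
    rw [ha] at h₁
    exact Nat.eq_of_mul_eq_mul_left (Nat.pos_of_ne_zero hN) h₁
  obtain ⟨j', rfl⟩ : k ∣ j := hg ▸ Nat.gcd_dvd_right (N * k) j
  have hcop : Nat.Coprime j' N := by
    rw [mul_comm N k, Nat.gcd_mul_left] at hg
    exact Nat.Coprime.symm (Nat.eq_of_mul_eq_mul_left (Nat.pos_of_ne_zero hk) (by rw [hg, mul_one]))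
  have : NeZero (N * k) := ⟨hNk⟩
  have : NeZero N := ⟨hN⟩
  -- Here a = c ^ (k * j') with `j'` coprime only to `N`. A unit `w` modulo `N * k` congruent to
  -- `j'` modulo `N` gives the same `k`-th power of `c ^ w` and also full order.
  obtain ⟨w, hw⟩ := ZMod.unitsMap_surjective (Dvd.intro k rfl : N ∣ N * k)
    (ZMod.unitOfCoprime j' hcop)
  refine ⟨c ^ (w : ZMod (N * k)).val, ?_, ?_⟩
  · rw [← pow_mul, pow_eq_pow_iff_modEq, hc, mul_comm k j']
    refine Nat.ModEq.mul_right' k ?_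
    rw [← ZMod.natCast_eq_natCast_iff]
    have h := congrArg (fun u : (ZMod N)ˣ => (u : ZMod N)) hw
    simpa [ZMod.unitsMap_def, ZMod.natCast_val] using h
  · rw [hfo.orderOf_pow, hc, Nat.Coprime.gcd_eq_one, Nat.div_one]
    exact (ZMod.val_coe_unit_coprime w).symm

/-- A compatible system of roots of `a`; the factorials ensure that every torsion element is a power
of some term. -/
theorem exists_seq (hA : IsUnitsLike A) {a : A} {n : ℕ} (hn : n ≠ 0) (ha : orderOf a = n) :
    ∃ s : ℕ → A, s 0 = a ∧ (∀ k, orderOf (s k) = n * k.factorial) ∧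
      ∀ k, s (k + 1) ^ (k + 1) = s k := by
  have h : ∀ (k : ℕ) (x : {x : A // orderOf x = n * k.factorial}),
      ∃ y : {x : A // orderOf x = n * (k + 1).factorial}, (y : A) ^ (k + 1) = x := by
    rintro k ⟨x, hx⟩
    obtain ⟨y, hy, hy'⟩ := hA.exists_pow_eq_orderOf
      (Nat.mul_ne_zero hn k.factorial_ne_zero) k.succ_ne_zero hx
    exact ⟨⟨y, by rw [hy', Nat.factorial_succ, Nat.succ_eq_add_one]; ring⟩, hy⟩
  choose f hf using h
  let s : ∀ k : ℕ, {x : A // orderOf x = n * k.factorial} :=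
    fun k => Nat.rec ⟨a, by simpa using ha⟩ f k
  exact ⟨fun k => (s k).1, rfl, fun k => (s k).2, fun k => hf k (s k)⟩

theorem exists_zpow_eq (hA : IsUnitsLike A) {n : ℕ} (hn : n ≠ 0) {s : ℕ → A}
    (hs : ∀ k, orderOf (s k) = n * k.factorial) {x : A} (hx : IsOfFinOrder x) :
    ∃ (k : ℕ) (j : ℤ), s k ^ j = x :=
  ⟨orderOf x, hA.mem_zpowers (Nat.mul_ne_zero hn (orderOf x).factorial_ne_zero) (hs (orderOf x))
    (orderOf_dvd_iff_pow_eq_one.1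
      (dvd_mul_of_dvd_right (Nat.dvd_factorial hx.orderOf_pos le_rfl) n))⟩

theorem exists_torsion_mulEquiv (hA : IsUnitsLike A) (hB : IsUnitsLike B) {n : ℕ} (hn : n ≠ 0)
    {a : A} {b : B} (ha : orderOf a = n) (hb : orderOf b = n) :
    Countable (CommGroup.torsion A) ∧
      ∃ θ : CommGroup.torsion A ≃* CommGroup.torsion B,
        ∀ x : CommGroup.torsion A, (x : A) = a → (θ x : B) = b := by
  obtain ⟨s, hs0, hso, hs⟩ := hA.exists_seq hn ha
  obtain ⟨t, ht0, hto, ht⟩ := hB.exists_seq hn hb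
  have hpow : ∀ k l, k ≤ l → ∃ d : ℕ, s l ^ d = s k ∧ t l ^ d = t k := by
    intro k l hkl
    induction l, hkl using Nat.le_induction with
    | base => exact ⟨1, by simp, by simp⟩
    | succ l _ ih =>
      obtain ⟨d, hd, hd'⟩ := ih
      exact ⟨(l + 1) * d, by rw [pow_mul, hs, hd], by rw [pow_mul, ht, hd']⟩
  -- The graph of the correspondence `s k ^ j ↦ t k ^ j`. Equal orders of `s k` and `t k` make both
  -- projections bijective onto the torsion, so no limit construction is needed.
  let Γ : Subgroup (A × B) :=
    { carrier := {p | ∃ (k : ℕ) (j : ℤ), p = (s k ^ j, t k ^ j)}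
      one_mem' := ⟨0, 0, by simp; rfl⟩
      inv_mem' := by
        rintro _ ⟨k, j, rfl⟩
        exact ⟨k, -j, by simp⟩
      mul_mem' := by
        rintro _ _ ⟨k, j, rfl⟩ ⟨k', j', rfl⟩
        obtain ⟨d, hd, hd'⟩ := hpow k _ (le_max_left k k')
        obtain ⟨e, he, he'⟩ := hpow k' _ (le_max_right k k')
        refine ⟨max k k', d * j + e * j', ?_⟩
        rw [Prod.mk_mul_mk, ← hd, ← hd', ← he, ← he']
        simp only [zpow_add, zpow_mul, zpow_natCast] }
  have hpos : ∀ k : ℕ, 0 < n * k.factorial := fun k =>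
    Nat.mul_pos (Nat.pos_of_ne_zero hn) k.factorial_pos
  have hsf : ∀ (k : ℕ) (j : ℤ), s k ^ j ∈ CommGroup.torsion A := fun k j =>
    (CommGroup.torsion A).zpow_mem (orderOf_pos_iff.1 (by rw [hso]; exact hpos k)) j
  have htf : ∀ (k : ℕ) (j : ℤ), t k ^ j ∈ CommGroup.torsion B := fun k j =>
    (CommGroup.torsion B).zpow_mem (orderOf_pos_iff.1 (by rw [hto]; exact hpos k)) j
  have hst : ∀ (k : ℕ) (j : ℤ), s k ^ j = 1 ↔ t k ^ j = 1 := fun k j => by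
    rw [← orderOf_dvd_iff_zpow_eq_one, ← orderOf_dvd_iff_zpow_eq_one, hso, hto]
  let f : Γ →* CommGroup.torsion A := ((MonoidHom.fst A B).comp Γ.subtype).codRestrict _ (by
    rintro ⟨_, k, j, rfl⟩; exact hsf k j)
  let g : Γ →* CommGroup.torsion B := ((MonoidHom.snd A B).comp Γ.subtype).codRestrict _ (by
    rintro ⟨_, k, j, rfl⟩; exact htf k j)
  have hf : Function.Bijective f := by
    refine ⟨(injective_iff_map_eq_one f).2 ?_, ?_⟩
    · rintro ⟨_, k, j, rfl⟩ h
      have h₁ : s k ^ j = 1 := congrArg Subtype.val h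
      exact Subtype.ext (Prod.ext h₁ ((hst k j).1 h₁))
    · rintro ⟨x, hx⟩
      obtain ⟨k, j, rfl⟩ := hA.exists_zpow_eq hn hso hx
      exact ⟨⟨(s k ^ j, t k ^ j), k, j, rfl⟩, rfl⟩
  have hg : Function.Bijective g := by
    refine ⟨(injective_iff_map_eq_one g).2 ?_, ?_⟩
    · rintro ⟨_, k, j, rfl⟩ h
      have h₁ : t k ^ j = 1 := congrArg Subtype.val h
      exact Subtype.ext (Prod.ext ((hst k j).2 h₁) h₁)
    · rintro ⟨x, hx⟩
      obtain ⟨k, j, rfl⟩ := hB.exists_zpow_eq hn hto hx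
      exact ⟨⟨(s k ^ j, t k ^ j), k, j, rfl⟩, rfl⟩
  refine ⟨?_, (MulEquiv.ofBijective f hf).symm.trans (MulEquiv.ofBijective g hg), fun x hx => ?_⟩
  · refine Function.Surjective.countable (α := ℕ × ℤ)
      (f := fun p => ⟨s p.1 ^ p.2, hsf p.1 p.2⟩) ?_
    rintro ⟨x, hx⟩
    obtain ⟨k, j, rfl⟩ := hA.exists_zpow_eq hn hso hx
    exact ⟨(k, j), rfl⟩
  · let y : Γ := ⟨(a, b), 0, 1, by simp [hs0, ht0]⟩
    have hy : (MulEquiv.ofBijective f hf).symm x = y :=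
      (MulEquiv.symm_apply_eq _).2 (Subtype.ext hx)
    rw [MulEquiv.trans_apply, hy]
    rfl

theorem exists_mulEquiv {A : Type u} {B : Type v} [CommGroup A] [CommGroup B]
    (hA : IsUnitsLike A) (hB : IsUnitsLike B) (hAB : Nonempty (A ≃ B))
    (hunc : Cardinal.aleph0 < Cardinal.mk A) {n : ℕ} (hn : n ≠ 0)
    {a : A} {b : B} (ha : orderOf a = n) (hb : orderOf b = n) : ∃ τ : A ≃* B, τ a = b := by
  obtain ⟨hc, θ, hθ⟩ := hA.exists_torsion_mulEquiv hB hn ha hb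
  let θ' : AddCommGroup.torsion (Additive A) ≃+ AddCommGroup.torsion (Additive B) :=
    { toFun := fun x => ⟨Additive.ofMul (θ ⟨x.1.toMul, isOfFinAddOrder_ofMul_iff.1 x.2⟩ : B),
        isOfFinAddOrder_ofMul_iff.2 (θ _).2⟩
      invFun := fun x => ⟨Additive.ofMul (θ.symm ⟨x.1.toMul, isOfFinAddOrder_ofMul_iff.1 x.2⟩ : A),
        isOfFinAddOrder_ofMul_iff.2 (θ.symm _).2⟩
      left_inv := fun x => Subtype.ext (congrArg Subtype.val (θ.symm_apply_apply _))
      right_inv := fun x => Subtype.ext (congrArg Subtype.val (θ.apply_symm_apply _))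
      map_add' := fun x y => Subtype.ext (congrArg Subtype.val (θ.map_mul _ _)) }
  have hcount : Countable (AddCommGroup.torsion (Additive A)) :=
    Function.Injective.countable (β := CommGroup.torsion A)
      (f := fun x => ⟨x.1.toMul, isOfFinAddOrder_ofMul_iff.1 x.2⟩)
      fun x y h => Subtype.ext (congrArg Subtype.val h)
  obtain ⟨τ, hτ⟩ := AddCommGroup.exists_addEquiv_extending (A := Additive A) (B := Additive B)
    hA.exists_pow hB.exists_pow hAB hunc θ'
  have haf : IsOfFinOrder a := orderOf_pos_iff.1 (by omega)
  exact ⟨AddEquiv.toMultiplicative τ, (hτ ⟨Additive.ofMul a, isOfFinAddOrder_ofMul_iff.2 haf⟩).trans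
    (hθ ⟨a, haf⟩ rfl)⟩

end IsUnitsLike

/-! ### Generation and perfectness of SLₙ. -/

theorem Fin.exists_ne_ne {n : ℕ} (hn : 3 ≤ n) (i k : Fin n) : ∃ j, j ≠ i ∧ j ≠ k := by
  obtain ⟨j, -, hj⟩ := Finset.exists_mem_notMem_of_card_lt_card (s := {i, k}) (t := Finset.univ)
    ((Finset.card_le_two).trans_lt (by rw [Finset.card_univ, Fintype.card_fin]; omega))
  rw [Finset.mem_insert, Finset.mem_singleton, not_or] at hj
  exact ⟨j, hj⟩

section SL

open Matrix SpecialLinearGroup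

variable {ι K : Type*} [Fintype ι] [DecidableEq ι] [Field K]

theorem Matrix.SpecialLinearGroup.commutator_transvection {i j k : ι} (hij : i ≠ j) (hjk : j ≠ k)
    (hik : i ≠ k) (a b : K) :
    ⁅SpecialLinearGroup.transvection hij a, SpecialLinearGroup.transvection hjk b⁆ =
      SpecialLinearGroup.transvection hik (a * b) := by
  rw [commutatorElement_def, transvection_inv, transvection_inv]
  refine Subtype.ext ?_
  simp [transvection_coe, mul_add, add_mul, single_mul_single_of_ne, hij.symm, hjk.symm,
    hik.symm, ← single_neg]
  abel

/-- Steinberg's formula h(c) = w(c)·w(-1), where w(c) = x(c)·y(-c⁻¹)·x(c) for opposite root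
subgroups x and y. -/
theorem Matrix.SpecialLinearGroup.diag2n_eq_prod {i j : ι} (hij : i ≠ j) {c : K} (hc : c ≠ 0) :
    diag2n hij c hc = SpecialLinearGroup.transvection hij c *
      SpecialLinearGroup.transvection hij.symm (-c⁻¹) * SpecialLinearGroup.transvection hij c *
      (SpecialLinearGroup.transvection hij (-1) * SpecialLinearGroup.transvection hij.symm 1 *
      SpecialLinearGroup.transvection hij (-1)) := by
  refine Subtype.ext ?_
  have hd : (diag2n hij c hc : Matrix ι ι K) = 1 + single i i (c - 1) + single j j (c⁻¹ - 1) := by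
    rw [diag2n_coe]
    ext a b
    by_cases hab : a = b
    · subst hab
      by_cases hai : a = i
      · subst hai
        simp [hij.symm]
      · by_cases haj : a = j
        · subst haj
          simp [hij, hai]
        · simp [hai, haj, Ne.symm hai, Ne.symm haj]
    · simp only [diagonal_apply_ne _ hab, add_apply, one_apply_ne hab, single_apply]
      rw [if_neg (by grind), if_neg (by grind)]
      simp
  rw [hd]
  simp only [coe_mul, transvection_coe, mul_add, add_mul, single_mul_single_same, one_mul,
    mul_one, single_mul_single_of_ne _ _ _ _ hij, single_mul_single_of_ne _ _ _ _ hij.symm, mul_neg,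
    neg_mul, mul_inv_cancel₀ hc, inv_mul_cancel₀ hc, add_zero]
  -- Matrix units become opaque vectors, leaving a linear identity.
  obtain ⟨S, hS⟩ : ∃ S : ι → ι → Matrix ι ι K, ∀ p q x, single p q x = x • S p q :=
    ⟨fun p q => single p q 1, fun p q x => by simp⟩
  simp only [hS]
  module

theorem Matrix.SpecialLinearGroup.eq_top_of_transvection_mem [Nontrivial ι]
    (S : Subgroup (SpecialLinearGroup ι K))
    (h : ∀ (i j : ι) (hij : i ≠ j) (a : K), SpecialLinearGroup.transvection hij a ∈ S) : S = ⊤ := by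
  refine eq_top_iff.2 fun M _ => diagonal_transvection_induction' (fun A => A ∈ S) M ?_ h
    fun A B hA hB => S.mul_mem hA hB
  intro i j hij c hc
  rw [diag2n_eq_prod hij hc]
  exact S.mul_mem (S.mul_mem (S.mul_mem (h _ _ _ _) (h _ _ _ _)) (h _ _ _ _))
    (S.mul_mem (S.mul_mem (h _ _ _ _) (h _ _ _ _)) (h _ _ _ _))

/-- A third index writes each transvection as a commutator, which needs `3 ≤ n`. -/
theorem Matrix.SpecialLinearGroup.commutator_eq_top {n : ℕ} (hn : 3 ≤ n) :
    commutator (SpecialLinearGroup (Fin n) K) = ⊤ := by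
  have : Nontrivial (Fin n) := Fin.nontrivial_iff_two_le.2 (by omega)
  refine eq_top_of_transvection_mem _ fun i k hik a => ?_
  obtain ⟨j, hji, hjk⟩ := Fin.exists_ne_ne hn i k
  rw [← mul_one a, ← commutator_transvection hji.symm hjk hik]
  exact Subgroup.commutator_mem_commutator (Subgroup.mem_top _) (Subgroup.mem_top _)

end SL

/-! ### Central products with SLₙ and the map `derivedCenterHom`. -/

/-- `G` is the product of its center with a subgroup isomorphic to `SLₙ(K)`. -/
def IsSLCentral (n : ℕ) (K : Type*) [Field K] (G : Type*) [Group G] : Prop :=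
  ∃ s : Matrix.SpecialLinearGroup (Fin n) K →* G, Function.Injective s ∧
    ∀ g, ∃ x, ∃ z ∈ Subgroup.center G, g = s x * z

theorem nonempty_rootsOfUnity_mulEquiv (K : Type*) [Field K] [IsAlgClosed K] [CharZero K] (n : ℕ)
    [NeZero n] : Nonempty (rootsOfUnity n K ≃* rootsOfUnity n ℂ) :=
  ⟨mulEquivOfCyclicCardEq (by
    rw [HasEnoughRootsOfUnity.natCard_rootsOfUnity, HasEnoughRootsOfUnity.natCard_rootsOfUnity])⟩

theorem MonoidHom.apply_mem_commutator {A B : Type*} [Group A] [Group B] (f : A →* B) {a : A}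
    (ha : a ∈ commutator A) : f a ∈ commutator B := by
  have h : (commutator A).map f ≤ commutator B := by
    rw [commutator_def, Subgroup.map_commutator, commutator_def]
    exact Subgroup.commutator_mono le_top le_top
  exact h ⟨a, ha, rfl⟩

section DerivedCenter

variable {G : Type*} [Group G]

theorem derivedCenterHom_apply (p : commutator G × Subgroup.center G) :
    derivedCenterHom G p = p.1 * p.2 := rfl

theorem mem_center_of_mem_ker_derivedCenterHom {p : commutator G × Subgroup.center G}
    (hp : p ∈ (derivedCenterHom G).ker) : (p.1 : G) ∈ Subgroup.center G := by
  rw [MonoidHom.mem_ker, derivedCenterHom_apply] at hp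
  rw [eq_inv_of_mul_eq_one_left hp]
  exact (Subgroup.center G).inv_mem p.2.2

theorem ker_derivedCenterHom_le_center :
    (derivedCenterHom G).ker ≤ Subgroup.center (commutator G × Subgroup.center G) := by
  intro p hp
  have h := Subgroup.mem_center_iff.1 (mem_center_of_mem_ker_derivedCenterHom hp)
  refine Subgroup.mem_center_iff.2 fun q => Prod.ext (Subtype.ext (h q.1))
    (Subtype.ext (Subgroup.mem_center_iff.1 p.2.2 q.2))

/-- The kernel consists of pairs (c, c⁻¹) with `c` central in `G`; surjectivity makes every central
element of the derived subgroup central in `G`. -/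
theorem nonempty_ker_derivedCenterHom_mulEquiv
    (hsurj : Function.Surjective (derivedCenterHom G)) :
    Nonempty ((derivedCenterHom G).ker ≃* Subgroup.center (commutator G)) := by
  let ψ : (derivedCenterHom G).ker →* Subgroup.center (commutator G) :=
    ((MonoidHom.fst _ _).comp (derivedCenterHom G).ker.subtype).codRestrict _ fun p =>
      Subgroup.mem_center_iff.2 fun q => Subtype.ext
        (Subgroup.mem_center_iff.1 (mem_center_of_mem_ker_derivedCenterHom p.2) q)
  refine ⟨MulEquiv.ofBijective ψ ⟨(injective_iff_map_eq_one ψ).2 ?_, ?_⟩⟩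
  · rintro ⟨⟨a, z⟩, hp⟩ h
    have h₁ : a = 1 := congrArg Subtype.val h
    subst h₁
    rw [MonoidHom.mem_ker, derivedCenterHom_apply] at hp
    have h₂ : z = 1 := Subtype.ext (by simpa using hp)
    subst h₂
    rfl
  · rintro ⟨c, hc⟩
    have hcG : (c : G) ∈ Subgroup.center G := by
      refine Subgroup.mem_center_iff.2 fun g => ?_
      obtain ⟨⟨a, z⟩, rfl⟩ := hsurj g
      have h₁ : (a : G) * c = c * a := congrArg Subtype.val (Subgroup.mem_center_iff.1 hc a)
      have h₂ : (z : G) * c = c * z := (Subgroup.mem_center_iff.1 z.2 c).symm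
      rw [derivedCenterHom_apply, mul_assoc, h₂, ← mul_assoc, h₁, mul_assoc]
    exact ⟨⟨(c, ⟨c, hcG⟩⁻¹), by simp [MonoidHom.mem_ker, derivedCenterHom_apply]⟩, rfl⟩

end DerivedCenter

section Decomposition

variable {n : ℕ} {K : Type*} [Field K] {G : Type*} [Group G]

theorem mem_center_iff_of_forall {s : Matrix.SpecialLinearGroup (Fin n) K →* G}
    (hs : ∀ g, ∃ x, ∃ z ∈ Subgroup.center G, g = s x * z) {g : G} :
    g ∈ Subgroup.center G ↔ ∀ x, s x * g = g * s x := by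
  rw [Subgroup.mem_center_iff]
  refine ⟨fun h x => h _, fun h k => ?_⟩
  obtain ⟨x, z, hz, rfl⟩ := hs k
  rw [Subgroup.mem_center_iff] at hz
  rw [mul_assoc, ← hz g, ← mul_assoc, h x, mul_assoc]

/-- Perfectness gives one inclusion; for the other, central factors drop out of commutators. -/
theorem range_eq_commutator (hn : 3 ≤ n) {s : Matrix.SpecialLinearGroup (Fin n) K →* G}
    (hs : ∀ g, ∃ x, ∃ z ∈ Subgroup.center G, g = s x * z) : s.range = commutator G := by
  apply le_antisymm
  · rintro _ ⟨x, rfl⟩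
    exact s.apply_mem_commutator
      (Matrix.SpecialLinearGroup.commutator_eq_top (K := K) hn ▸ Subgroup.mem_top x)
  · rw [commutator_def, Subgroup.commutator_le]
    intro g _ h _
    obtain ⟨x, z, hz, rfl⟩ := hs g
    obtain ⟨y, w, hw, rfl⟩ := hs h
    refine ⟨⁅x, y⁆, ?_⟩
    rw [map_commutatorElement]
    rw [Subgroup.mem_center_iff] at hz hw
    have h₁ : z * (s y * w) * z⁻¹ = s y * w := by rw [← hz, mul_inv_cancel_right]
    have h₂ : w * (s x)⁻¹ * w⁻¹ = (s x)⁻¹ := by rw [← hw, mul_inv_cancel_right]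
    calc ⁅s x, s y⁆ = s x * s y * (w * (s x)⁻¹ * w⁻¹) * (s y)⁻¹ := by
          rw [h₂, commutatorElement_def]
      _ = s x * (s y * w) * (s x)⁻¹ * (s y * w)⁻¹ := by group
      _ = s x * (z * (s y * w) * z⁻¹) * (s x)⁻¹ * (s y * w)⁻¹ := by rw [h₁]
      _ = ⁅s x * z, s y * w⁆ := by rw [commutatorElement_def]; group

theorem IsSLCentral.nonempty_commutator_mulEquiv (hn : 3 ≤ n) (h : IsSLCentral n K G) :
    Nonempty (commutator G ≃* Matrix.SpecialLinearGroup (Fin n) K) := by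
  obtain ⟨s, hinj, hs⟩ := h
  exact ⟨((MonoidHom.ofInjective hinj).trans
    (MulEquiv.subgroupCongr (range_eq_commutator hn hs))).symm⟩

theorem IsSLCentral.surjective_derivedCenterHom (hn : 3 ≤ n) (h : IsSLCentral n K G) :
    Function.Surjective (derivedCenterHom G) := by
  obtain ⟨s, -, hs⟩ := h
  intro g
  obtain ⟨x, z, hz, rfl⟩ := hs g
  exact ⟨(⟨s x, range_eq_commutator hn hs ▸ ⟨x, rfl⟩⟩, ⟨z, hz⟩), rfl⟩

theorem IsSLCentral.nonempty_ker_mulEquiv [IsAlgClosed K] [CharZero K] (hn : 3 ≤ n)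
    (h : IsSLCentral n K G) : Nonempty ((derivedCenterHom G).ker ≃* rootsOfUnity n ℂ) := by
  have : NeZero n := ⟨by omega⟩
  obtain ⟨e₁⟩ := nonempty_ker_derivedCenterHom_mulEquiv (h.surjective_derivedCenterHom hn)
  obtain ⟨e₂⟩ := h.nonempty_commutator_mulEquiv hn
  obtain ⟨e₃⟩ := nonempty_rootsOfUnity_mulEquiv K n
  have e₄ := Matrix.SpecialLinearGroup.center_equiv_rootsOfUnity' (R := K) (0 : Fin n)
  rw [Fintype.card_fin] at e₄
  exact ⟨((e₁.trans (Subgroup.centerCongr e₂)).trans e₄).trans e₃⟩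

theorem IsSLCentral.isCentralIsogeny [IsAlgClosed K] [CharZero K] (hn : 3 ≤ n)
    (h : IsSLCentral n K G) : IsCentralIsogeny (derivedCenterHom G) where
  surjective := h.surjective_derivedCenterHom hn
  finite_ker := by
    have : NeZero n := ⟨by omega⟩
    obtain ⟨e⟩ := h.nonempty_ker_mulEquiv hn
    exact Finite.of_equiv _ e.symm.toEquiv
  ker_le_center := ker_derivedCenterHom_le_center

/-- The isomorphism `β` is arbitrary, not assumed to be induced by `derivedCenterHom`. Still, the
composite from the product to `G` sends the perfect first factor into the derived subgroup and,
being onto, the second into the center. -/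
theorem isSLCentral_of_mulEquiv (hn : 3 ≤ n)
    (β : G ≃* (commutator G × Subgroup.center G) ⧸ (derivedCenterHom G).ker)
    (e : commutator G ≃* Matrix.SpecialLinearGroup (Fin n) K) : IsSLCentral n K G := by
  let γ : commutator G × Subgroup.center G →* G :=
    β.symm.toMonoidHom.comp (QuotientGroup.mk' (derivedCenterHom G).ker)
  have hγ : Function.Surjective γ :=
    β.symm.surjective.comp (QuotientGroup.mk'_surjective _)
  have hperf : commutator (commutator G) = ⊤ := by
    have h₁ := Subgroup.map_commutator ⊤ ⊤ e.symm.toMonoidHom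
    rw [← commutator_def, Matrix.SpecialLinearGroup.commutator_eq_top hn] at h₁
    rw [Subgroup.map_top_of_surjective _ e.symm.surjective] at h₁
    exact h₁.symm
  have h₁ : ∀ a : commutator G, γ (a, 1) ∈ commutator G := by
    intro a
    exact (γ.comp (MonoidHom.inl _ _)).apply_mem_commutator (hperf ▸ Subgroup.mem_top a)
  refine ⟨(commutator G).subtype.comp e.symm.toMonoidHom,
    Subtype.val_injective.comp e.symm.injective, fun g => ?_⟩
  obtain ⟨⟨a, z⟩, rfl⟩ := hγ g
  refine ⟨e ⟨_, h₁ a⟩, γ (1, z), Subgroup.mem_center_iff.2 fun k => ?_, ?_⟩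
  · obtain ⟨⟨b, w⟩, rfl⟩ := hγ k
    rw [← map_mul, ← map_mul]
    have h₂ : w * z = z * w := Subtype.ext (Subgroup.mem_center_iff.1 z.2 w)
    simp [h₂]
  · simp [← map_mul]

end Decomposition

/-! ### Units-like groups under elementary maps, ultrapowers and elementary equivalence. -/

open Filter

theorem IsDef.orderOf_eq {H G α : Type*} [Group H] [Group G] {f : H → G} {a : (α → G) → G}
    (ha : IsWord f a) {m : ℕ} (hm : m ≠ 0) : IsDef f (fun v => orderOf (a v) = m) := by
  simp only [orderOf_eq_iff (Nat.pos_of_ne_zero hm)]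
  refine (IsDef.eq (ha.pow m) IsWord.one).and ?_
  have h : IsDef f fun v => ∀ k ∈ (Finset.range m).filter (0 < ·), a v ^ k ≠ 1 :=
    IsDef.forall_finset _ fun k _ => (IsDef.eq (ha.pow k) IsWord.one).not
  simpa only [Finset.mem_filter, Finset.mem_range, and_imp] using h

theorem Matrix.GeneralLinearGroup.scalar_injective {n : ℕ} [NeZero n] {K : Type*} [Field K] :
    Function.Injective (scalar (Fin n) : Kˣ →* GeneralLinearGroup (Fin n) K) := by
  intro a b hab
  have h := congrArg (fun M : GeneralLinearGroup (Fin n) K => M.1 0 0) hab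
  exact Units.ext (by simpa using h)

namespace IsUnitsLike

section

variable {A B : Type*} [Group A] [Group B]

theorem of_mulEquiv (hA : IsUnitsLike A) (e : A ≃* B) : IsUnitsLike B where
  exists_pow m hm x := by
    obtain ⟨y, hy⟩ := hA.exists_pow m hm (e.symm x)
    exact ⟨e y, by rw [← map_pow, hy, e.apply_symm_apply]⟩
  exists_generator m hm := by
    obtain ⟨c, hc, h⟩ := hA.exists_generator m hm
    refine ⟨e c, by rw [MulEquiv.orderOf_eq, hc], fun x hx => ?_⟩
    obtain ⟨k, hk⟩ := h (e.symm x) (by rw [← map_pow, hx, map_one])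
    refine ⟨k, ?_⟩
    simp only at hk ⊢
    rw [← map_zpow, hk, e.apply_symm_apply]

theorem infinite (hA : IsUnitsLike A) : Infinite A := by
  by_contra h
  rw [not_infinite_iff_finite] at h
  obtain ⟨c, hc, -⟩ := hA.exists_generator (Nat.card A + 1) (Nat.succ_ne_zero _)
  have := orderOf_le_card (G := A) (x := c)
  omega

theorem germ (hA : IsUnitsLike A) {I : Type*} (U : Ultrafilter I) :
    IsUnitsLike (Germ (U : Filter I) A) where
  exists_pow m hm x := by
    induction x using Germ.inductionOn with
    | _ x =>
      choose y hy using fun i => hA.exists_pow m hm (x i)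
      exact ⟨(y : Germ (U : Filter I) A), by rw [← Germ.coe_pow]; exact congrArg _ (funext hy)⟩
  exists_generator m hm := by
    classical
    obtain ⟨c, hc, h⟩ := hA.exists_generator m hm
    let F : A →* Germ (U : Filter I) A :=
      (Germ.coeMulHom (U : Filter I)).comp (Pi.constMonoidHom I A)
    have hF : Function.Injective F := fun a b hab => Germ.const_inj.1 hab
    refine ⟨F c, by rw [orderOf_injective F hF, hc], fun x hx => ?_⟩
    induction x using Germ.inductionOn with
    | _ x =>
      have h₁ : ∀ᶠ i in U, x i ^ m = 1 := by
        rw [← Germ.coe_pow] at hx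
        exact Germ.coe_eq.1 hx
      have hfo : IsOfFinOrder c := orderOf_pos_iff.1 (by omega)
      have h₂ : ∀ᶠ i in U, ∃ k : Fin m, c ^ (k : ℕ) = x i := h₁.mono fun i hi => by
        obtain ⟨k, hk, hk'⟩ := Finset.mem_image.1 (hfo.mem_zpowers_iff_mem_range_orderOf.1 (h _ hi))
        exact ⟨⟨k, by rw [← hc]; exact Finset.mem_range.1 hk⟩, hk'⟩
      -- Only `m` exponents are possible, so one of them works on a large set.
      obtain ⟨k, hk⟩ := Ultrafilter.eventually_exists_iff.1 h₂
      refine Subgroup.mem_zpowers_iff.2 ⟨(k : ℕ), ?_⟩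
      rw [zpow_natCast, ← map_pow]
      exact Germ.coe_eq.2 hk

end

open scoped IsMulCommutative in
theorem center_of_isElementary {H G : Type*} [Group H] [Group G] {f : H → G} (hf : IsElementary f)
    (hG : IsUnitsLike (Subgroup.center G)) : IsUnitsLike (Subgroup.center H) where
  exists_pow m hm z := by
    obtain ⟨y, hy⟩ := hG.exists_pow m hm ⟨f z, hf.mem_center_iff.2 z.2⟩
    obtain ⟨h, hh, hh'⟩ := hf.exists_mem (S := {y | y ∈ Subgroup.center G ∧ y ^ m = f z})
      ((isDefSet_center.mem (IsWord.var _)).and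
        (IsDef.eq ((IsWord.var _).pow m) (IsWord.const _)))
      ⟨y, y.2, congrArg Subtype.val hy⟩
    exact ⟨⟨h, hf.mem_center_iff.1 hh⟩, Subtype.ext (hf.injective (by simpa [hf.map_pow] using hh'))⟩
  exists_generator m hm := by
    obtain ⟨c, hc, -⟩ := hG.exists_generator m hm
    obtain ⟨h, hh, hh'⟩ := hf.exists_mem (S := {y | y ∈ Subgroup.center G ∧ orderOf y = m})
      ((isDefSet_center.mem (IsWord.var _)).and (IsDef.orderOf_eq (IsWord.var _) hm))
      ⟨c, c.2, by rw [Subgroup.orderOf_coe, hc]⟩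
    refine ⟨⟨h, hf.mem_center_iff.1 hh⟩, ?_, fun x hx => ?_⟩
    · rw [Subgroup.orderOf_mk, ← orderOf_injective hf.hom hf.injective, hf.hom_apply, hh']
    · have h₁ := hG.mem_zpowers hm (c := ⟨f h, hh⟩) (x := ⟨f x, hf.mem_center_iff.2 x.2⟩)
        (by rw [Subgroup.orderOf_mk, hh'])
        (Subtype.ext (by
          have h₂ := congrArg (fun y : Subgroup.center H => f y) hx
          simpa [hf.map_pow, hf.map_one] using h₂))
      obtain ⟨k, hk⟩ := Subgroup.mem_zpowers_iff.1 h₁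
      refine Subgroup.mem_zpowers_iff.2 ⟨k, Subtype.ext (hf.injective ?_)⟩
      have h₂ := congrArg Subtype.val hk
      have h₃ : f (h ^ k) = f h ^ k := _root_.map_zpow hf.hom h k
      simpa [h₃] using h₂

theorem units (K : Type*) [Field K] [IsAlgClosed K] [CharZero K] : IsUnitsLike Kˣ where
  exists_pow m hm x := by
    obtain ⟨y, hy⟩ := IsAlgClosed.exists_pow_nat_eq (x : K) (Nat.pos_of_ne_zero hm)
    have hy0 : y ≠ 0 := by
      rintro rfl
      rw [zero_pow hm] at hy
      exact x.ne_zero hy.symm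
    exact ⟨Units.mk0 y hy0, Units.ext hy⟩
  exists_generator m hm := by
    have : NeZero m := ⟨hm⟩
    obtain ⟨ζ, hζ⟩ := HasEnoughRootsOfUnity.exists_primitiveRoot K m
    have h := hζ.isUnit_unit hm
    refine ⟨(hζ.isUnit hm).unit, h.eq_orderOf.symm, fun x hx => ?_⟩
    rw [h.zpowers_eq]
    exact hx

theorem center_generalLinearGroup (n : ℕ) [NeZero n] (K : Type*) [Field K] [IsAlgClosed K]
    [CharZero K] : IsUnitsLike (Subgroup.center (Matrix.GeneralLinearGroup (Fin n) K)) := by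
  exact (units K).of_mulEquiv ((MonoidHom.ofInjective
    Matrix.GeneralLinearGroup.scalar_injective).trans
    (MulEquiv.subgroupCongr Matrix.GeneralLinearGroup.center_eq_range_scalar.symm))

end IsUnitsLike

theorem Subgroup.mem_center_germ {G I : Type*} [Group G] {U : Ultrafilter I} {x : I → G} :
    (x : Germ (U : Filter I) G) ∈ center (Germ (U : Filter I) G) ↔ ∀ᶠ i in U, x i ∈ center G := by
  rw [Subgroup.mem_center_iff]
  constructor
  · intro h
    by_contra hc
    rw [← Ultrafilter.eventually_not] at hc
    have h₁ : ∀ i, ∃ g, x i ∉ center G → g * x i ≠ x i * g := fun i => by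
      by_cases hi : x i ∈ center G
      · exact ⟨1, fun h => absurd hi h⟩
      · rw [Subgroup.mem_center_iff] at hi
        push Not at hi
        exact ⟨_, fun _ => hi.choose_spec⟩
    choose g hg using h₁
    obtain ⟨i, hi, hi'⟩ := (hc.and (Germ.coe_eq.1 (h g))).exists
    exact hg i hi hi'
  · intro h g
    induction g using Germ.inductionOn with
    | _ g => exact Germ.coe_eq.2 (h.mono fun i hi => Subgroup.mem_center_iff.1 hi (g i))

theorem nonempty_germ_center_mulEquiv {G I : Type*} [Group G] (U : Ultrafilter I) :
    Nonempty (Germ (U : Filter I) (Subgroup.center G) ≃*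
      Subgroup.center (Germ (U : Filter I) G)) := by
  classical
  let ψ : (I → Subgroup.center G) →* Subgroup.center (Germ (U : Filter I) G) :=
    ((Germ.coeMulHom (U : Filter I)).comp ((Subgroup.center G).subtype.compLeft I)).codRestrict _
      fun x => Subgroup.mem_center_germ.2 (Eventually.of_forall fun i => (x i).2)
  refine Filter.Germ.nonempty_mulEquiv (ψ := ψ) ?_ ?_
  · rintro ⟨x, hx⟩
    induction x using Germ.inductionOn with
    | _ x =>
      refine ⟨fun i => if h : x i ∈ Subgroup.center G then ⟨x i, h⟩ else 1, Subtype.ext ?_⟩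
      refine Germ.coe_eq.2 ((Subgroup.mem_center_germ.1 hx).mono fun i hi => ?_)
      simp [hi]
  · intro x
    rw [Subtype.ext_iff]
    refine Germ.coe_eq.trans (eventually_congr (Eventually.of_forall fun i => ?_))
    exact (Subtype.ext_iff (a1 := x i) (a2 := 1)).symm

theorem exists_embedding_pi_bool {A κ : Type*} (g : A ↪ κ) : Nonempty (A ↪ (κ → Bool)) := by
  classical
  refine ⟨⟨fun a k => decide (k = g a), fun a b hab => ?_⟩⟩
  have h := congrFun hab (g a)
  exact g.injective (by simpa using h)

theorem GroupElemEquiv.isUnitsLike {A : Type u} [Group A] [IsMulCommutative A]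
    (h : GroupElemEquiv A ℂˣ) : IsUnitsLike A := by
  obtain ⟨I, U, f, hf⟩ := h.exists_isElementary
  have h₁ := IsUnitsLike.center_of_isElementary hf
    (((IsUnitsLike.units ℂ).germ U).of_mulEquiv
      (Subgroup.topEquiv.symm.trans (MulEquiv.subgroupCongr Subgroup.center_eq_top.symm)))
  exact h₁.of_mulEquiv
    ((MulEquiv.subgroupCongr Subgroup.center_eq_top).trans Subgroup.topEquiv)

open scoped IsMulCommutative in
theorem IsUnitsLike.groupElemEquiv {A : Type u} [Group A] [IsMulCommutative A]
    (hA : IsUnitsLike A) : GroupElemEquiv A ℂˣ := by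
  have hC := IsUnitsLike.units ℂ
  have := hA.infinite
  have := hC.infinite
  obtain ⟨g₁⟩ := exists_embedding_pi_bool (A := A) (κ := A ⊕ ℂˣ) .inl
  obtain ⟨g₂⟩ := exists_embedding_pi_bool (A := ℂˣ) (κ := A ⊕ ℂˣ) .inr
  obtain ⟨e₁⟩ := nonempty_germ_equiv g₁
  obtain ⟨e₂⟩ := nonempty_germ_equiv g₂
  have hA' := hA.germ (regularUltrafilter (A ⊕ ℂˣ))
  have hC' := hC.germ (regularUltrafilter (A ⊕ ℂˣ))
  -- No elements have to be matched here, so the trivial order `1` suffices.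
  obtain ⟨a, ha, -⟩ := hA'.exists_generator 1 one_ne_zero
  obtain ⟨b, hb, -⟩ := hC'.exists_generator 1 one_ne_zero
  obtain ⟨τ, -⟩ := hA'.exists_mulEquiv hC' ⟨e₁.trans e₂.symm⟩ (aleph0_lt_of_equiv e₁)
    one_ne_zero ha hb
  exact Language.ElementarilyEquivalent.trans (Filter.Germ.groupElemEquiv)
    (Language.ElementarilyEquivalent.trans (GroupElemEquiv.of_mulEquiv τ)
      (Language.ElementarilyEquivalent.symm Filter.Germ.groupElemEquiv))

/-! ### Gluing SLₙ with the center, and elementary equivalence with GLₙ. -/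

section SLCentral

variable {n : ℕ} {K : Type*} [Field K] {G : Type*} [Group G]

theorem Matrix.GeneralLinearGroup.exists_eq_toGL_mul_scalar [IsAlgClosed K] (hn : n ≠ 0)
    (g : Matrix.GeneralLinearGroup (Fin n) K) : ∃ (x : Matrix.SpecialLinearGroup (Fin n) K) (c : Kˣ),
      g = Matrix.SpecialLinearGroup.toGL x * Matrix.GeneralLinearGroup.scalar (Fin n) c := by
  obtain ⟨c, hc⟩ := IsAlgClosed.exists_pow_nat_eq (g.det : K) (Nat.pos_of_ne_zero hn)
  have hc0 : c ≠ 0 := by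
    rintro rfl
    rw [zero_pow hn] at hc
    exact g.det.ne_zero hc.symm
  let z : Matrix.GeneralLinearGroup (Fin n) K :=
    Matrix.GeneralLinearGroup.scalar (Fin n) (Units.mk0 c hc0)
  have hdet : (z.1).det = c ^ n := by
    simp [z]
  have hdet' : (g * z⁻¹).1.det = 1 := by
    have h : (g * z⁻¹).1.det * z.1.det = g.1.det := by
      rw [← Matrix.det_mul, ← Units.val_mul, inv_mul_cancel_right]
    rw [hdet, hc] at h
    exact mul_right_cancel₀ g.det.ne_zero (h.trans (one_mul _).symm)
  exact ⟨⟨(g * z⁻¹).1, hdet'⟩, Units.mk0 c hc0, eq_mul_of_mul_inv_eq (Units.ext rfl)⟩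

theorem isSLCentral_generalLinearGroup [IsAlgClosed K] (hn : n ≠ 0) :
    IsSLCentral n K (Matrix.GeneralLinearGroup (Fin n) K) := by
  refine ⟨Matrix.SpecialLinearGroup.toGL, Matrix.SpecialLinearGroup.toGL_injective, fun g => ?_⟩
  obtain ⟨x, c, rfl⟩ := Matrix.GeneralLinearGroup.exists_eq_toGL_mul_scalar hn g
  refine ⟨x, _, ?_, rfl⟩
  rw [Matrix.GeneralLinearGroup.center_eq_range_scalar]
  exact ⟨_, rfl⟩

theorem IsSLCentral.of_ringEquiv {K' : Type*} [Field K'] (h : IsSLCentral n K G) (e : K ≃+* K') :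
    IsSLCentral n K' G := by
  obtain ⟨s, hinj, hs⟩ := h
  have hl : ∀ x, Matrix.SpecialLinearGroup.map (n := Fin n) e.symm.toRingHom
      (Matrix.SpecialLinearGroup.map e.toRingHom x) = x := fun x => by
    ext i j
    simp
  have hr : ∀ x, Matrix.SpecialLinearGroup.map (n := Fin n) e.toRingHom
      (Matrix.SpecialLinearGroup.map e.symm.toRingHom x) = x := fun x => by
    ext i j
    simp
  refine ⟨s.comp (Matrix.SpecialLinearGroup.map e.symm.toRingHom),
    hinj.comp (Function.LeftInverse.injective hr), fun g => ?_⟩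
  obtain ⟨x, z, hz, rfl⟩ := hs g
  exact ⟨Matrix.SpecialLinearGroup.map e.toRingHom x, z, hz, by
    rw [MonoidHom.comp_apply, hl]⟩

theorem IsSLCentral.germ (h : IsSLCentral n K G) {I : Type*} (U : Ultrafilter I) :
    IsSLCentral n (Germ (U : Filter I) K) (Germ (U : Filter I) G) := by
  obtain ⟨s, hinj, hs⟩ := h
  obtain ⟨e⟩ := nonempty_germ_specialLinearGroup_mulEquiv (n := Fin n) (F := K) (U := U)
  let s' : Germ (U : Filter I) (Matrix.SpecialLinearGroup (Fin n) K) →* Germ (U : Filter I) G :=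
    { toFun := Germ.map s
      map_one' := congrArg _ (funext fun _ => s.map_one)
      map_mul' := fun x y => Germ.inductionOn₂ x y fun x y =>
        congrArg _ (funext fun _ => s.map_mul _ _) }
  have hs' : ∀ x : I → Matrix.SpecialLinearGroup (Fin n) K,
      s' (x : Germ (U : Filter I) (Matrix.SpecialLinearGroup (Fin n) K)) =
        ((fun i => s (x i) : I → G) : Germ (U : Filter I) G) := fun _ => rfl
  have hinj' : Function.Injective s' := by
    intro x y
    refine Germ.inductionOn₂ x y fun x y hxy => ?_
    rw [hs', hs'] at hxy
    exact Germ.coe_eq.2 ((Germ.coe_eq.1 hxy).mono fun i hi => hinj hi)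
  refine ⟨s'.comp e.symm.toMonoidHom, hinj'.comp e.symm.injective, fun g => ?_⟩
  induction g using Germ.inductionOn with
  | _ g =>
    choose x z hz hg using fun i => hs (g i)
    refine ⟨e (x : Germ (U : Filter I) _), (z : Germ (U : Filter I) G),
      Subgroup.mem_center_germ.2 (Eventually.of_forall hz), ?_⟩
    have h₁ : s'.comp e.symm.toMonoidHom (e (x : Germ (U : Filter I) _)) =
        s' (x : Germ (U : Filter I) _) := congrArg s' (e.symm_apply_apply _)
    rw [h₁, hs', ← Germ.coe_mul]
    exact congrArg _ (funext hg)

theorem exists_generator_center_specialLinearGroup [IsAlgClosed K] [CharZero K] (n : ℕ) [NeZero n] :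
    ∃ C ∈ Subgroup.center (Matrix.SpecialLinearGroup (Fin n) K), orderOf C = n ∧
      ∀ x ∈ Subgroup.center (Matrix.SpecialLinearGroup (Fin n) K), x ∈ Subgroup.zpowers C := by
  have e := Matrix.SpecialLinearGroup.center_equiv_rootsOfUnity' (R := K) (0 : Fin n)
  rw [Fintype.card_fin] at e
  have : IsCyclic (Subgroup.center (Matrix.SpecialLinearGroup (Fin n) K)) :=
    isCyclic_of_injective e.toMonoidHom e.injective
  obtain ⟨C, hC⟩ := IsCyclic.exists_generator
    (α := Subgroup.center (Matrix.SpecialLinearGroup (Fin n) K))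
  refine ⟨C, C.2, ?_, fun x hx => ?_⟩
  · rw [Subgroup.orderOf_coe, orderOf_eq_card_of_forall_mem_zpowers hC, Nat.card_congr e.toEquiv,
      HasEnoughRootsOfUnity.natCard_rootsOfUnity]
  · obtain ⟨k, hk⟩ := Subgroup.mem_zpowers_iff.1 (hC ⟨x, hx⟩)
    exact Subgroup.mem_zpowers_iff.2 ⟨k, congrArg Subtype.val hk⟩

/-- A kernel pair has `x` central in `S`, hence a power of `C`, and `z` is then the inverse power of
`s₁ C`; so `τ` need only be controlled at `s₁ C`. -/
theorem mul_map_eq_one_of_mul_eq_one {S G₁ G₂ : Type*} [Group S] [Group G₁] [Group G₂]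
    {s₁ : S →* G₁} {s₂ : S →* G₂} (hinj : Function.Injective s₁) {C : S}
    (hC : ∀ x ∈ Subgroup.center S, x ∈ Subgroup.zpowers C) (h₁ : s₁ C ∈ Subgroup.center G₁)
    (h₂ : s₂ C ∈ Subgroup.center G₂) (τ : Subgroup.center G₁ →* Subgroup.center G₂)
    (hτ : τ ⟨s₁ C, h₁⟩ = ⟨s₂ C, h₂⟩) {x : S} {z : Subgroup.center G₁} (hxz : s₁ x * z = 1) :
    s₂ x * τ z = 1 := by
  have hx : x ∈ Subgroup.center S := by
    refine Subgroup.mem_center_iff.2 fun y => hinj ?_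
    rw [map_mul, map_mul, eq_inv_of_mul_eq_one_left hxz]
    exact Subgroup.mem_center_iff.1 ((Subgroup.center G₁).inv_mem z.2) _
  obtain ⟨k, rfl⟩ := Subgroup.mem_zpowers_iff.1 (hC x hx)
  obtain rfl : z = (⟨s₁ C, h₁⟩ ^ k)⁻¹ := Subtype.ext (by
    rw [map_zpow] at hxz
    simpa using (inv_eq_of_mul_eq_one_right hxz).symm)
  rw [map_inv, map_zpow, map_zpow, hτ]
  simp

open scoped IsMulCommutative in
-- Both groups are quotients of SLₙ(K) × Z(G₁), the second through `τ`. Matching the images of a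
-- generator of Z(SLₙ) makes the two kernels equal.
theorem IsSLCentral.nonempty_mulEquiv [IsAlgClosed K] [CharZero K] (hn : n ≠ 0)
    {G₁ : Type u} {G₂ : Type v} [Group G₁] [Group G₂] (h₁ : IsSLCentral n K G₁)
    (h₂ : IsSLCentral n K G₂) (hZ₁ : IsUnitsLike (Subgroup.center G₁))
    (hZ₂ : IsUnitsLike (Subgroup.center G₂))
    (hZ : Nonempty (Subgroup.center G₁ ≃ Subgroup.center G₂))
    (hunc : Cardinal.aleph0 < Cardinal.mk (Subgroup.center G₁)) : Nonempty (G₁ ≃* G₂) := by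
  obtain ⟨s₁, hinj₁, hs₁⟩ := h₁
  obtain ⟨s₂, hinj₂, hs₂⟩ := h₂
  have : NeZero n := ⟨hn⟩
  obtain ⟨C, hCc, hCo, hC⟩ := exists_generator_center_specialLinearGroup (K := K) n
  have hC₁ : s₁ C ∈ Subgroup.center G₁ := (mem_center_iff_of_forall hs₁).2 fun x => by
    rw [← map_mul, ← map_mul, Subgroup.mem_center_iff.1 hCc]
  have hC₂ : s₂ C ∈ Subgroup.center G₂ := (mem_center_iff_of_forall hs₂).2 fun x => by
    rw [← map_mul, ← map_mul, Subgroup.mem_center_iff.1 hCc]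
  obtain ⟨τ, hτ⟩ := hZ₁.exists_mulEquiv hZ₂ hZ hunc hn (a := ⟨s₁ C, hC₁⟩) (b := ⟨s₂ C, hC₂⟩)
    (by rw [Subgroup.orderOf_mk, orderOf_injective s₁ hinj₁, hCo])
    (by rw [Subgroup.orderOf_mk, orderOf_injective s₂ hinj₂, hCo])
  let φ₁ := s₁.noncommCoprod (Subgroup.center G₁).subtype
    fun x z => Subgroup.mem_center_iff.1 z.2 (s₁ x)
  let φ₂ := s₂.noncommCoprod ((Subgroup.center G₂).subtype.comp τ.toMonoidHom)
    fun x z => Subgroup.mem_center_iff.1 (τ z).2 (s₂ x)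
  refine MonoidHom.nonempty_mulEquiv_of_ker_eq (f := φ₁) (g := φ₂) ?_ ?_ ?_
  · intro g
    obtain ⟨x, z, hz, rfl⟩ := hs₁ g
    exact ⟨(x, ⟨z, hz⟩), rfl⟩
  · intro g
    obtain ⟨x, z, hz, rfl⟩ := hs₂ g
    refine ⟨(x, τ.symm ⟨z, hz⟩), ?_⟩
    simp [φ₂]
  · ext ⟨x, z⟩
    constructor
    · intro h
      exact mul_map_eq_one_of_mul_eq_one hinj₁ hC hC₁ hC₂ τ.toMonoidHom hτ h
    · intro h
      have h' := mul_map_eq_one_of_mul_eq_one hinj₂ hC hC₂ hC₁ τ.symm.toMonoidHom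
        (by rw [← hτ]; exact τ.symm_apply_apply _) (x := x) (z := τ z) h
      have h₃ : τ.symm.toMonoidHom (τ z) = z := τ.symm_apply_apply z
      rw [h₃] at h'
      exact h'

theorem nonempty_germ_equiv_of_embedding {κ A : Type*} [Infinite κ] [Infinite A] (g : A ↪ κ) :
    Nonempty (Germ (regularUltrafilter κ : Filter (Finset κ)) A ≃ (κ → Bool)) := by
  obtain ⟨g'⟩ := exists_embedding_pi_bool g
  exact nonempty_germ_equiv g'

theorem IsSLCentral.groupElemEquiv {F : Type u} [Field F] [IsAlgClosed F] [CharZero F] {L : Type v}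
    [Field L] [IsAlgClosed L] [CharZero L] {H : Type*} [Group H] (hn : n ≠ 0)
    (h : IsSLCentral n L H) (hZ : IsUnitsLike (Subgroup.center H)) :
    GroupElemEquiv H (Matrix.GeneralLinearGroup (Fin n) F) := by
  have : NeZero n := ⟨hn⟩
  have hZ' := IsUnitsLike.center_generalLinearGroup n F
  have := hZ.infinite
  have := hZ'.infinite
  have : Infinite L := Infinite.of_injective _ (Nat.cast_injective (R := L))
  have : Infinite F := Infinite.of_injective _ (Nat.cast_injective (R := F))
  -- One index set into which both fields and both centers embed, so that a single ultrafilter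
  -- equalizes all four cardinalities.
  let κ := (L ⊕ F) ⊕ (Subgroup.center H ⊕ Subgroup.center (Matrix.GeneralLinearGroup (Fin n) F))
  let U := regularUltrafilter κ
  obtain ⟨e₁⟩ := nonempty_germ_equiv_of_embedding (A := L) (κ := κ)
    (Function.Embedding.inl.trans Function.Embedding.inl)
  obtain ⟨e₂⟩ := nonempty_germ_equiv_of_embedding (A := F) (κ := κ)
    (Function.Embedding.inr.trans Function.Embedding.inl)
  obtain ⟨e₃⟩ := nonempty_germ_equiv_of_embedding (A := Subgroup.center H) (κ := κ)
    (Function.Embedding.inl.trans Function.Embedding.inr)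
  obtain ⟨e₄⟩ := nonempty_germ_equiv_of_embedding
    (A := Subgroup.center (Matrix.GeneralLinearGroup (Fin n) F)) (κ := κ)
    (Function.Embedding.inr.trans Function.Embedding.inr)
  obtain ⟨r⟩ := IsAlgClosed.ringEquiv_of_equiv_of_charZero (aleph0_lt_of_equiv e₁)
    ⟨e₁.trans e₂.symm⟩
  obtain ⟨c₁⟩ := nonempty_germ_center_mulEquiv (G := H) U
  obtain ⟨c₂⟩ := nonempty_germ_center_mulEquiv (G := Matrix.GeneralLinearGroup (Fin n) F) U
  obtain ⟨ε⟩ := ((h.germ U).of_ringEquiv r).nonempty_mulEquiv hn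
    ((isSLCentral_generalLinearGroup (K := F) hn).germ U) ((hZ.germ U).of_mulEquiv c₁)
    ((hZ'.germ U).of_mulEquiv c₂)
    ⟨((c₁.symm.toEquiv.trans e₃).trans e₄.symm).trans c₂.toEquiv⟩
    (aleph0_lt_of_equiv (c₁.symm.toEquiv.trans e₃))
  exact Language.ElementarilyEquivalent.trans (Filter.Germ.groupElemEquiv)
    (Language.ElementarilyEquivalent.trans (GroupElemEquiv.of_mulEquiv ε)
      (Language.ElementarilyEquivalent.symm Filter.Germ.groupElemEquiv))

end SLCentral

/-! ### Fields elementarily equivalent to `F`, via the complete theory ACF₀. -/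

section FieldElemEquiv

variable {L F : Type*} [Field L] [Field F]

theorem FieldElemEquiv.model_ACF [IsAlgClosed F] [CharZero F] (h : FieldElemEquiv L F) :
    IsAlgClosed L ∧ CharZero L := by
  let := FirstOrder.Ring.compatibleRingOfRing L
  let := FirstOrder.Ring.compatibleRingOfRing F
  have h₁ : F ⊨ Language.Theory.ACF 0 := inferInstance
  have h₂ : L ⊨ Language.Theory.ACF 0 :=
    (Language.ElementarilyEquivalent.theory_model_iff h).2 h₁
  have := FirstOrder.Field.charP_of_model_fieldOfChar 0 L
  exact ⟨FirstOrder.Field.isAlgClosed_of_model_ACF 0 L, CharP.charP_to_charZero L⟩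

theorem fieldElemEquiv_of_isAlgClosed [IsAlgClosed L] [CharZero L] [IsAlgClosed F] [CharZero F] :
    FieldElemEquiv L F := by
  let := FirstOrder.Ring.compatibleRingOfRing L
  let := FirstOrder.Ring.compatibleRingOfRing F
  have hc := FirstOrder.Field.ACF_isComplete (p := 0) (Or.inr rfl)
  refine Language.elementarilyEquivalent_iff.2 fun φ => ?_
  rw [hc.realize_sentence_iff, hc.realize_sentence_iff]

end FieldElemEquiv

/-! ### The diagonal torus and its root elements in GLₙ. -/

namespace Matrix.GeneralLinearGroup

variable {ι K : Type*} [Fintype ι] [DecidableEq ι] [Field K]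

/-- The diagonal matrices in `GL`. -/
def diag : (ι → Kˣ) →* GeneralLinearGroup ι K :=
  (Units.map (diagonalRingHom ι K).toMonoidHom).comp MulEquiv.piUnits.symm.toMonoidHom

theorem coe_diag (w : ι → Kˣ) : (diag w : Matrix ι ι K) = diagonal fun i => (w i : K) := rfl

/-- The elementary matrix `1 + a Eᵢⱼ` in `GL`. -/
def elem {i j : ι} (hij : i ≠ j) (a : K) : GeneralLinearGroup ι K :=
  SpecialLinearGroup.toGL (SpecialLinearGroup.transvection hij a)

theorem coe_elem {i j : ι} (hij : i ≠ j) (a : K) :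
    (elem hij a : Matrix ι ι K) = 1 + single i j a := rfl

theorem elem_injective {i j : ι} (hij : i ≠ j) : Function.Injective (elem (K := K) hij) := by
  intro a b hab
  have h := congrArg (fun M : GeneralLinearGroup ι K => M.1 i j) hab
  simpa [coe_elem, hij] using h

theorem elem_mul {i j : ι} (hij : i ≠ j) (a b : K) :
    elem hij a * elem hij b = elem hij (a + b) := by
  refine Units.ext ?_
  rw [Units.val_mul, coe_elem, coe_elem, coe_elem]
  simp [mul_add, add_mul, hij.symm, single_add, add_assoc, add_comm, add_left_comm]

@[simp] theorem elem_zero {i j : ι} (hij : i ≠ j) : elem hij (0 : K) = 1 :=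
  Units.ext (by simp [coe_elem])

theorem elem_inv {i j : ι} (hij : i ≠ j) (a : K) : (elem hij a)⁻¹ = elem hij (-a) := by
  rw [inv_eq_iff_mul_eq_one, elem_mul, add_neg_cancel, elem_zero]

theorem elem_eq_one {i j : ι} (hij : i ≠ j) {a : K} : elem hij a = 1 ↔ a = 0 := by
  rw [← elem_zero hij, (elem_injective hij).eq_iff]

theorem commutator_elem {i j k : ι} (hij : i ≠ j) (hjk : j ≠ k) (hik : i ≠ k) (a b : K) :
    ⁅elem hij a, elem hjk b⁆ = elem hik (a * b) := by
  rw [elem, elem, ← map_commutatorElement, SpecialLinearGroup.commutator_transvection hij hjk hik]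
  rfl

theorem diag_mul_apply (w : ι → Kˣ) (g : GeneralLinearGroup ι K) (i j : ι) :
    (diag w * g).1 i j = w i * g.1 i j := by
  rw [Units.val_mul, coe_diag, diagonal_mul]

theorem mul_diag_apply (w : ι → Kˣ) (g : GeneralLinearGroup ι K) (i j : ι) :
    (g * diag w).1 i j = g.1 i j * w j := by
  rw [Units.val_mul, coe_diag, mul_diagonal]

theorem diag_conj_apply (w : ι → Kˣ) (g : GeneralLinearGroup ι K) (i j : ι) :
    (diag w * g * (diag w)⁻¹).1 i j = w i * g.1 i j * (w j : K)⁻¹ := by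
  rw [← map_inv, mul_diag_apply, diag_mul_apply, Pi.inv_apply, Units.val_inv_eq_inv_val]

theorem mul_diag_conj_apply (w : ι → Kˣ) (g g' : GeneralLinearGroup ι K) (i j : ι) :
    (g * (diag w * g' * (diag w)⁻¹)).1 i j = (∑ l, g.1 i l * g'.1 l j * w l) * (w j : K)⁻¹ := by
  rw [Units.val_mul, mul_apply, Finset.sum_mul]
  exact Finset.sum_congr rfl fun l _ => by rw [diag_conj_apply]; ring

theorem diag_conj_mul_apply (w : ι → Kˣ) (g g' : GeneralLinearGroup ι K) (i j : ι) :
    (diag w * g' * (diag w)⁻¹ * g).1 i j = w i * ∑ l, g'.1 i l * g.1 l j * (w l : K)⁻¹ := by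
  rw [Units.val_mul, mul_apply, Finset.mul_sum]
  exact Finset.sum_congr rfl fun l _ => by rw [diag_conj_apply]; ring

theorem diag_conj_elem (w : ι → Kˣ) {i j : ι} (hij : i ≠ j) (a : K) :
    diag w * elem hij a * (diag w)⁻¹ = elem hij (w i * a * (w j : K)⁻¹) := by
  ext k l
  rw [diag_conj_apply, coe_elem, coe_elem, add_apply, add_apply, single_apply, single_apply]
  by_cases hkl : k = l
  · subst hkl
    rw [if_neg (by grind), if_neg (by grind)]
    simp
  · rw [one_apply_ne hkl]
    split_ifs with h
    · rw [h.1, h.2]; ring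
    · simp

theorem mem_range_diag {g : GeneralLinearGroup ι K} (hg : ∀ i j, i ≠ j → g.1 i j = 0) :
    g ∈ (diag (ι := ι) (K := K)).range := by
  have hd : g.1 = diagonal fun i => g.1 i i := by
    ext i j
    by_cases hij : i = j
    · subst hij; simp
    · rw [diagonal_apply_ne _ hij, hg i j hij]
  have h0 : ∀ i, g.1 i i ≠ 0 := by
    intro i hi
    have h₁ : g.1.det ≠ 0 := g.det.ne_zero
    rw [hd, det_diagonal] at h₁
    exact h₁ (Finset.prod_eq_zero (Finset.mem_univ i) hi)
  exact ⟨fun i => Units.mk0 _ (h0 i), Units.ext hd.symm⟩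

/-- A diagonal element with distinct entries has the torus as centralizer, which makes the torus
definable from one parameter. -/
theorem mem_range_diag_iff_commute {d : ι → Kˣ} (hd : Function.Injective d)
    {g : GeneralLinearGroup ι K} :
    g ∈ (diag (ι := ι) (K := K)).range ↔ g * diag d = diag d * g := by
  constructor
  · rintro ⟨w, rfl⟩
    rw [← map_mul, ← map_mul, mul_comm]
  · intro h
    refine mem_range_diag fun i j hij => ?_
    have h₁ := congrArg (fun M : GeneralLinearGroup ι K => M.1 i j) h
    simp only [mul_diag_apply, diag_mul_apply] at h₁
    by_contra h₂
    rw [mul_comm] at h₁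
    exact hij (hd (Units.ext (mul_right_cancel₀ h₂ h₁))).symm

/-- Elements `u ∉ T` such that `u` commutes with its conjugates under the torus `T` of diagonal
matrices, and the product of `u` with each of them is trivial or conjugate to `u` under `T`. -/
def rootElements (ι K : Type*) [Fintype ι] [DecidableEq ι] [Field K] :
    Set (GeneralLinearGroup ι K) :=
  {u | u ∉ (diag (ι := ι) (K := K)).range ∧ ∀ t, t ∈ (diag (ι := ι) (K := K)).range →
    u * (t * u * t⁻¹) = t * u * t⁻¹ * u ∧ (u * (t * u * t⁻¹) = 1 ∨
      ∃ s, s ∈ (diag (ι := ι) (K := K)).range ∧ u * (t * u * t⁻¹) = s * u * s⁻¹)}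

theorem elem_notMem_range_diag {i j : ι} (hij : i ≠ j) {a : K} (ha : a ≠ 0) :
    elem hij a ∉ (diag (ι := ι) (K := K)).range := by
  rintro ⟨w, hw⟩
  have h := congrArg (fun M : GeneralLinearGroup ι K => M.1 i j) hw
  simp only [coe_diag, coe_elem, diagonal_apply_ne _ hij, add_apply, one_apply_ne hij,
    single_apply_same, zero_add] at h
  exact ha h.symm

theorem exists_diag_conj_elem {i j : ι} (hij : i ≠ j) {a b : K} (ha : a ≠ 0) (hb : b ≠ 0) :
    ∃ s, s ∈ (diag (ι := ι) (K := K)).range ∧ s * elem hij a * s⁻¹ = elem hij b := by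
  refine ⟨_, ⟨Pi.mulSingle i (Units.mk0 (b / a) (div_ne_zero hb ha)), rfl⟩, ?_⟩
  rw [diag_conj_elem]
  simp [Pi.mulSingle_eq_of_ne hij.symm, ha]

theorem elem_mem_rootElements {i j : ι} (hij : i ≠ j) {a : K} (ha : a ≠ 0) :
    elem hij a ∈ rootElements ι K := by
  refine ⟨elem_notMem_range_diag hij ha, ?_⟩
  rintro _ ⟨w, rfl⟩
  rw [diag_conj_elem, elem_mul, elem_mul, add_comm]
  refine ⟨rfl, ?_⟩
  by_cases h : w i * a * (w j : K)⁻¹ + a = 0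
  · exact Or.inl (by rw [h, elem_zero])
  · obtain ⟨s, hs, hs'⟩ := exists_diag_conj_elem hij ha h
    exact Or.inr ⟨s, hs, hs'.symm⟩

/-- Explicit torus elements are inserted into the two defining conditions: commutation kills
products of off-diagonal entries, and the conjugacy alternative forces a unit diagonal and a single
nonzero off-diagonal entry. -/
theorem exists_eq_elem_of_mem_rootElements [CharZero K] {u : GeneralLinearGroup ι K}
    (hu : u ∈ rootElements ι K) : ∃ (i j : ι) (hij : i ≠ j) (a : K), a ≠ 0 ∧ u = elem hij a := by
  obtain ⟨hu, h⟩ := hu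
  have hcomm : ∀ (w : ι → Kˣ) i j, (∑ l, u.1 i l * u.1 l j * w l) * (w j : K)⁻¹ =
      w i * ∑ l, u.1 i l * u.1 l j * (w l : K)⁻¹ := by
    intro w i j
    rw [← mul_diag_conj_apply, ← diag_conj_mul_apply, (h _ ⟨w, rfl⟩).1]
  have hzero : ∀ i j l, l ≠ i → l ≠ j → u.1 i l * u.1 l j = 0 := by
    intro i j l hli hlj
    have hsum : ∀ v : ι → K, (∀ x, x ≠ l → v x = 1) → ∑ x, u.1 i x * u.1 x j * v x =
        ∑ x, u.1 i x * u.1 x j + u.1 i l * u.1 l j * (v l - 1) := by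
      intro v hv
      rw [← Finset.sum_add_sum_compl {l} (fun x => u.1 i x * u.1 x j * v x),
        ← Finset.sum_add_sum_compl {l} (fun x => u.1 i x * u.1 x j),
        Finset.sum_congr (s₁ := ({l} : Finset ι)ᶜ) rfl
          fun x hx => by rw [hv x (by simpa using hx), mul_one] ]
      simp only [Finset.sum_singleton]
      ring
    -- With entry 2 in place `l`, the two sides differ by (2 - 1) - (1/2 - 1) = 3/2 times the
    -- product in question.
    have h₁ := hcomm (Pi.mulSingle l (Units.mk0 2 two_ne_zero)) i j
    rw [Pi.mulSingle_eq_of_ne hli.symm, Pi.mulSingle_eq_of_ne hlj.symm,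
      hsum _ fun x hx => by rw [Pi.mulSingle_eq_of_ne hx, Units.val_one],
      hsum _ fun x hx => by rw [Pi.mulSingle_eq_of_ne hx, Units.val_one, inv_one] ] at h₁
    simp only [Pi.mulSingle_eq_same, Units.val_mk0, Units.val_one, inv_one, mul_one, one_mul] at h₁
    linear_combination (2 / 3 : K) * h₁
  have hdiag : ∀ i, u.1 i i ≠ 0 := by
    have hdet : u.1.det ≠ 0 := u.det.ne_zero
    rw [det_apply] at hdet
    -- A nonzero Leibniz term whose `σ` moves `i` would contain two factors with zero product by
    -- `hzero`.
    obtain ⟨σ, -, hσ⟩ := Finset.exists_ne_zero_of_sum_ne_zero hdet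
    have hσ' : ∀ i, u.1 (σ i) i ≠ 0 := fun i hi =>
      hσ (by rw [Finset.prod_eq_zero (f := fun i => u.1 (σ i) i) (Finset.mem_univ i) hi, smul_zero])
    intro i hi
    have h₁ : σ i ≠ i := fun h => hσ' i (by rw [h, hi])
    have h₂ : σ (σ i) ≠ σ i := fun h => h₁ (σ.injective h)
    exact mul_ne_zero (hσ' (σ i)) (hσ' i) (hzero _ _ _ h₂.symm h₁)
  have hP : ∀ (w : ι → Kˣ) i j, i ≠ j → (u * (diag w * u * (diag w)⁻¹)).1 i j =
      u.1 i j * (u.1 i i * w i + u.1 j j * w j) * (w j : K)⁻¹ := by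
    intro w i j hij
    rw [mul_diag_conj_apply, Finset.sum_eq_add i j hij
      (fun l _ hl => by rw [hzero i j l hl.1 hl.2, zero_mul]) (by simp) (by simp)]
    ring
  have hPd : ∀ (w : ι → Kˣ) i, (u * (diag w * u * (diag w)⁻¹)).1 i i = u.1 i i * u.1 i i := by
    intro w i
    rw [mul_diag_conj_apply, Finset.sum_eq_single i
      (fun l _ hl => by rw [hzero i i l hl hl, zero_mul]) (by simp),
      mul_inv_cancel_right₀ (w i).ne_zero]
  have hone : ∀ i, u.1 i i = 1 := by
    intro i
    by_contra hi
    -- Torus conjugation preserves the diagonal, and the square of a nonzero entry other than 1 is a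
    -- different entry; only the alternative `= 1` remains.
    have h₁ : ∀ w, u * (diag w * u * (diag w)⁻¹) = 1 := by
      intro w
      refine (h _ ⟨w, rfl⟩).2.resolve_right ?_
      rintro ⟨_, ⟨s, rfl⟩, hs⟩
      have h₂ := hPd w i
      rw [hs, diag_conj_apply, mul_right_comm, mul_inv_cancel₀ (s i).ne_zero, one_mul] at h₂
      exact hi (mul_right_cancel₀ (hdiag i) (by rw [one_mul, ← h₂]))
    refine hu (mem_range_diag fun i j hij => ?_)
    by_contra hne
    have h₂ := hP 1 i j hij
    have h₃ := hP (Pi.mulSingle i (Units.mk0 2 two_ne_zero)) i j hij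
    rw [h₁, Units.val_one, one_apply_ne hij] at h₂ h₃
    rw [Pi.mulSingle_eq_same, Pi.mulSingle_eq_of_ne hij.symm] at h₃
    simp only [Pi.one_apply, Units.val_one, inv_one, mul_one, Units.val_mk0] at h₂ h₃
    have h₄ : u.1 i j * u.1 i i = 0 := by linear_combination h₂ - h₃
    exact mul_ne_zero hne (hdiag i) h₄
  obtain ⟨i, j, hij, hne⟩ : ∃ i j, i ≠ j ∧ u.1 i j ≠ 0 := by
    by_contra hc
    push Not at hc
    exact hu (mem_range_diag hc)
  have hP1 : ∀ w : ι → Kˣ, (w i : K) + w j = 0 → u * (diag w * u * (diag w)⁻¹) = 1 := by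
    intro w hw
    refine (h _ ⟨w, rfl⟩).2.resolve_right ?_
    rintro ⟨_, ⟨s, rfl⟩, hs⟩
    have h₂ := hP w i j hij
    rw [hs, diag_conj_apply, hone, hone, one_mul, one_mul, hw, mul_zero, zero_mul] at h₂
    exact mul_ne_zero (mul_ne_zero (s i).ne_zero hne) (inv_ne_zero (s j).ne_zero) h₂
  have hoff : ∀ k l, k ≠ l → u.1 k l ≠ 0 → k = i ∧ l = j := by
    intro k l hkl hkl0
    -- If `m` is `i` or `j` but neither `k` nor `l`, the torus element with -1 in place `m` makes
    -- the product trivial by `hP1`, whereas its (k, l) entry is twice that of `u`.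
    have hm : ∀ m, m = i ∨ m = j → m = k ∨ m = l := by
      intro m hm
      by_contra hc
      push Not at hc
      have h₁ := hP (Pi.mulSingle m (-1)) k l hkl
      rw [hP1 _ (by
        rcases hm with rfl | rfl
        · simp [Pi.mulSingle_eq_of_ne hij.symm]
        · simp [Pi.mulSingle_eq_of_ne hij]), Units.val_one, one_apply_ne hkl,
        Pi.mulSingle_eq_of_ne hc.1.symm, Pi.mulSingle_eq_of_ne hc.2.symm, hone, hone] at h₁
      simp only [Units.val_one, mul_one, inv_one] at h₁
      rcases mul_eq_zero.1 h₁.symm with h₂ | h₂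
      · exact hkl0 h₂
      · norm_num at h₂
    rcases hm i (Or.inl rfl) with h₁ | h₁ <;> rcases hm j (Or.inr rfl) with h₂ | h₂
    · exact absurd (h₁.trans h₂.symm) hij
    · exact ⟨h₁.symm, h₂.symm⟩
    · subst h₁ h₂
      exact absurd (hzero i i j hij.symm hij.symm) (mul_ne_zero hne hkl0)
    · exact absurd (h₁.trans h₂.symm) hij
  refine ⟨i, j, hij, u.1 i j, hne, ?_⟩
  ext k l
  rw [coe_elem, add_apply, single_apply]
  by_cases hkl : k = l
  · subst hkl
    rw [if_neg (by grind), hone]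
    simp
  · rw [one_apply_ne hkl, zero_add]
    split_ifs with hc
    · rw [hc.1, hc.2]
    · by_contra h₁
      exact hc ⟨(hoff k l hkl h₁).1.symm, (hoff k l hkl h₁).2.symm⟩

/-! ### Elements conjugate to a central multiple of themselves. -/

section Diagonalization

variable {n : ℕ} {K : Type*} [Field K]

/-- Elements that are conjugate to their product with a central element of order `n`. -/
def shiftElements (n : ℕ) (K : Type*) [Field K] : Set (GeneralLinearGroup (Fin n) K) :=
  {x | ∃ z, (z ∈ Subgroup.center (GeneralLinearGroup (Fin n) K) ∧ orderOf z = n) ∧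
    ∃ g, z * x * g = g * x}

/-- The clock and shift matrices: diag(ζ^i) and a cyclic permutation matrix commute up to the scalar
`ζ`. -/
theorem shiftElements_nonempty [NeZero n] [IsAlgClosed K] [CharZero K] :
    (shiftElements n K).Nonempty := by
  obtain ⟨ζ, hζ, -⟩ := (IsUnitsLike.units K).exists_generator n (NeZero.ne n)
  let σ : Equiv.Perm (Fin n) := Equiv.addRight 1
  let g : GeneralLinearGroup (Fin n) K := mkOfDetNeZero (σ.permMatrix K) (by
    rw [det_permutation]
    exact_mod_cast (Units.isUnit _).ne_zero)
  refine ⟨diag fun i => ζ ^ (i : ℕ), scalar (Fin n) ζ, ⟨?_, ?_⟩, g, ?_⟩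
  · rw [center_eq_range_scalar]
    exact ⟨_, rfl⟩
  · rw [orderOf_injective _ scalar_injective, hζ]
  · ext i j
    rw [mul_diag_apply, mul_assoc, Units.val_mul]
    have h₁ : (scalar (Fin n) ζ : GeneralLinearGroup (Fin n) K).1 = diagonal fun _ => (ζ : K) := rfl
    rw [h₁, diagonal_mul, diag_mul_apply]
    have h₂ : g.1 i j = if σ i = j then 1 else 0 := by
      change σ.permMatrix K i j = _
      simp [Equiv.Perm.permMatrix, PEquiv.toMatrix_apply, eq_comm]
    rw [h₂]
    split_ifs with h
    · rw [← h, mul_one, one_mul, ← Units.val_mul, ← pow_succ']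
      congr 1
      have h₃ : ((σ i : Fin n) : ℕ) = (i + 1) % n := by
        simp [σ, Fin.val_add]
      rw [h₃]
      -- The wrap-around at the last index is absorbed by ζ^n = 1.
      conv_lhs => rw [← pow_mod_orderOf, hζ]
    · simp

/-- If `v` is an eigenvector of `x` for `c`, then `g ^ i` applied to `v` is one for ω⁻ⁱc. As `ω` has
order `n`, these are `n` distinct eigenvalues, and the vectors form the columns of a diagonalizing
matrix. -/
theorem exists_conj_eq_diag_of_mem_shiftElements [NeZero n] [IsAlgClosed K]
    {x : GeneralLinearGroup (Fin n) K} (hx : x ∈ shiftElements n K) :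
    ∃ (q : GeneralLinearGroup (Fin n) K) (d : Fin n → Kˣ), Function.Injective d ∧
      q * x * q⁻¹ = diag d := by
  obtain ⟨z, ⟨hz, hzn⟩, g, hg⟩ := hx
  rw [center_eq_range_scalar] at hz
  obtain ⟨ω, rfl⟩ := hz
  rw [orderOf_injective _ scalar_injective] at hzn
  obtain ⟨c, hc⟩ := Module.End.exists_eigenvalue (Matrix.toLin' x.1)
  obtain ⟨v, hv⟩ := hc.exists_hasEigenvector
  have hxv : x.1 *ᵥ v = c • v := by
    have h := hv.apply_eq_smul
    rwa [Matrix.toLin'_apply] at h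
  have hc0 : c ≠ 0 := by
    rintro rfl
    refine hv.2 ?_
    have h : (x⁻¹ * x).1 *ᵥ v = 0 := by
      rw [Units.val_mul, ← mulVec_mulVec, hxv, zero_smul, mulVec_zero]
    rwa [inv_mul_cancel, Units.val_one, one_mulVec] at h
  let d : Fin n → Kˣ := fun i => ω⁻¹ ^ (i : ℕ) * Units.mk0 c hc0
  have hd : Function.Injective d := by
    intro i j hij
    have h := mul_right_cancel hij
    refine Fin.ext (pow_injOn_Iio_orderOf (x := ω⁻¹) ?_ ?_ h) <;>
    · rw [orderOf_inv, hzn]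
      exact Fin.is_lt _
  have hxg : ∀ w : Fin n → K, x.1 *ᵥ (g.1 *ᵥ w) = (ω : K)⁻¹ • (g.1 *ᵥ (x.1 *ᵥ w)) := by
    intro w
    rw [mulVec_mulVec, mulVec_mulVec, ← Units.val_mul, ← Units.val_mul, ← hg, mul_assoc,
      Units.val_mul (scalar (Fin n) ω)]
    have h₁ : (scalar (Fin n) ω : GeneralLinearGroup (Fin n) K).1 = (ω : K) • 1 :=
      (smul_one_eq_diagonal _).symm
    rw [h₁, smul_mul_assoc, one_mul, smul_mulVec, smul_smul, inv_mul_cancel₀ ω.ne_zero, one_smul]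
  have hpow : ∀ i : ℕ, x.1 *ᵥ ((g ^ i).1 *ᵥ v) = ((ω : K)⁻¹ ^ i * c) • ((g ^ i).1 *ᵥ v) := by
    intro i
    induction i with
    | zero => simpa using hxv
    | succ i ih =>
      rw [pow_succ', Units.val_mul, ← mulVec_mulVec, hxg, ih, mulVec_smul, smul_smul]
      congr 1
      ring
  have hind : LinearIndependent K fun i : Fin n => (g ^ (i : ℕ)).1 *ᵥ v := by
    refine Module.End.eigenvectors_linearIndependent' (Matrix.toLin' x.1) (fun i => (d i : K))
      (Units.val_injective.comp hd) _ fun i => ⟨?_, fun h => hv.2 ?_⟩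
    · rw [Module.End.mem_eigenspace_iff, Matrix.toLin'_apply, hpow]
      simp [d]
    · have h₁ : ((g ^ (i : ℕ))⁻¹ * g ^ (i : ℕ)).1 *ᵥ v = 0 := by
        rw [Units.val_mul, ← mulVec_mulVec, h, mulVec_zero]
      rwa [inv_mul_cancel, Units.val_one, one_mulVec] at h₁
  let Q : Matrix (Fin n) (Fin n) K := of fun a i => ((g ^ (i : ℕ)).1 *ᵥ v) a
  have hQ : IsUnit Q := linearIndependent_cols_iff_isUnit.1 hind
  refine ⟨hQ.unit⁻¹, d, hd, ?_⟩
  rw [inv_inv, mul_assoc, inv_mul_eq_iff_eq_mul]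
  ext a i
  rw [mul_diag_apply, Units.val_mul]
  have h := congrFun (hpow i) a
  rw [IsUnit.unit_spec]
  simp only [Pi.smul_apply, smul_eq_mul] at h
  change (x.1 *ᵥ ((g ^ (i : ℕ)).1 *ᵥ v)) a = ((g ^ (i : ℕ)).1 *ᵥ v) a * _
  rw [h, mul_comm]
  simp [d]

end Diagonalization

end Matrix.GeneralLinearGroup

/-! ### Definability of torus and root subgroups; normalizing an elementary map. -/

theorem isDefSet_shiftElements {n : ℕ} (hn : n ≠ 0) {K H : Type*} [Field K] [Group H]
    {f : H → Matrix.GeneralLinearGroup (Fin n) K} :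
    IsDefSet f (Matrix.GeneralLinearGroup.shiftElements n K) :=
  IsDef.ex (((isDefSet_center.mem (IsWord.var _)).and (IsDef.orderOf_eq (IsWord.var _) hn)).and
    (IsDef.ex (IsDef.eq (((IsWord.var _).mul (IsWord.var _)).mul (IsWord.var _))
      ((IsWord.var _).mul (IsWord.var _)))))

open Matrix.GeneralLinearGroup

section Frame

variable {n : ℕ} {K H : Type*} [Field K] [Group H] {f : H → Matrix.GeneralLinearGroup (Fin n) K}

theorem IsDef.congr {α G : Type*} [Group G] {f : H → G} {P Q : (α → G) → Prop} (hP : IsDef f P)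
    (hPQ : ∀ v, P v ↔ Q v) : IsDef f Q := by
  obtain ⟨φ, hφ⟩ := hP
  exact ⟨φ, fun v => (hφ v).trans (hPQ v)⟩

theorem isDefSet_range_diag {d : Fin n → Kˣ} (hd : Function.Injective d)
    (hmem : diag d ∈ Set.range f) : IsDefSet f ((diag (ι := Fin n) (K := K)).range : Set _) := by
  have h : IsDef f fun v : Unit → Matrix.GeneralLinearGroup (Fin n) K =>
      v () * diag d = diag d * v () :=
    IsDef.eq ((IsWord.var _).mul (IsWord.of_mem hmem)) ((IsWord.of_mem hmem).mul (IsWord.var _))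
  simpa only [IsDefSet, SetLike.mem_coe, mem_range_diag_iff_commute hd] using h

theorem isDefSet_rootElements
    (hT : IsDefSet f ((diag (ι := Fin n) (K := K)).range : Set _)) :
    IsDefSet f (rootElements (Fin n) K) := by
  refine (hT.mem (IsWord.var _)).not.and (IsDef.all ((hT.mem (IsWord.var _)).imp ?_))
  have hc : IsWord f fun w : Unit ⊕ Unit → Matrix.GeneralLinearGroup (Fin n) K =>
      w (Sum.inr ()) * w (Sum.inl ()) * (w (Sum.inr ()))⁻¹ :=
    ((IsWord.var _).mul (IsWord.var _)).mul (IsWord.var _).inv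
  refine (IsDef.eq ((IsWord.var _).mul hc) (hc.mul (IsWord.var _))).and
    ((IsDef.eq ((IsWord.var _).mul hc) IsWord.one).or (IsDef.ex ((hT.mem (IsWord.var _)).and
      (IsDef.eq ((IsWord.var _).mul (((IsWord.var _).mul (IsWord.var _)).mul (IsWord.var _).inv))
        (((IsWord.var _).mul (IsWord.var _)).mul (IsWord.var _).inv)))))

theorem Matrix.GeneralLinearGroup.eq_of_elem_eq_elem {i j k l : Fin n} {hij : i ≠ j} {hkl : k ≠ l}
    {a b : K} (ha : a ≠ 0) (h : elem hij a = elem hkl b) : k = i ∧ l = j := by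
  have h₁ := congrArg (fun M : Matrix.GeneralLinearGroup (Fin n) K => M.1 i j) h
  simp only [coe_elem, Matrix.add_apply, Matrix.one_apply_ne hij, Matrix.single_apply_same,
    zero_add, Matrix.single_apply] at h₁
  by_contra hc
  rw [if_neg hc] at h₁
  exact ha h₁

/-- A single root subgroup is not yet known to be definable. Fix one image point in each position
that the image meets; root elements not torus-conjugate to any of these form a definable set. A
missed position would make it nonempty, and an image point in it would contradict transitivity of
the torus on its position. -/
theorem IsElementary.exists_elem_mem_range [CharZero K] (hf : IsElementary f)
    (hT : IsDefSet f ((diag (ι := Fin n) (K := K)).range : Set _)) {i j : Fin n} (hij : i ≠ j) :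
    ∃ a, a ≠ 0 ∧ elem hij a ∈ Set.range f := by
  classical
  by_contra hc
  let P : Fin n × Fin n → H → Prop := fun p h =>
    ∃ (hp : p.1 ≠ p.2) (a : K), a ≠ 0 ∧ f h = elem hp a
  let s : Finset (Fin n × Fin n) := Finset.univ.filter fun p => ∃ h, P p h
  have hs : ∀ p, ∃ h, p ∈ s → P p h := fun p => by
    by_cases hp : ∃ h, P p h
    · exact ⟨hp.choose, fun _ => hp.choose_spec⟩
    · exact ⟨1, fun h => absurd (Finset.mem_filter.1 h).2 hp⟩
  choose c hc' using hs
  obtain ⟨h, hh, hh'⟩ := hf.exists_mem (S := {u | u ∈ rootElements (Fin n) K ∧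
      ∀ p ∈ s, ¬ ∃ t, t ∈ (diag (ι := Fin n) (K := K)).range ∧ t * f (c p) * t⁻¹ = u})
    (((isDefSet_rootElements hT).mem (IsWord.var _)).and (IsDef.forall_finset _ fun p _ =>
      (IsDef.ex ((hT.mem (IsWord.var _)).and (IsDef.eq
        (((IsWord.var _).mul (IsWord.const _)).mul (IsWord.var _).inv) (IsWord.var _)))).not))
    ⟨elem hij 1, elem_mem_rootElements hij one_ne_zero, by
      rintro p hp ⟨_, ⟨w, rfl⟩, hw⟩
      obtain ⟨hp', a, ha, hpa⟩ := hc' p hp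
      rw [hpa, diag_conj_elem] at hw
      obtain ⟨k, l⟩ := p
      obtain ⟨rfl, rfl⟩ := eq_of_elem_eq_elem one_ne_zero hw.symm
      exact hc ⟨a, ha, _, hpa⟩⟩
  obtain ⟨k, l, hkl, a, ha, hka⟩ := exists_eq_elem_of_mem_rootElements hh
  have hmem : (k, l) ∈ s := Finset.mem_filter.2 ⟨Finset.mem_univ _, h, hkl, a, ha, hka⟩
  obtain ⟨_, b, hb, hcb⟩ := hc' _ hmem
  obtain ⟨t, ht, ht'⟩ := exists_diag_conj_elem hkl hb ha
  exact hh' _ hmem ⟨t, ht, by rw [hcb, ht', hka]⟩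

theorem isDefSet_range_elem (hT : IsDefSet f ((diag (ι := Fin n) (K := K)).range : Set _))
    {i j : Fin n} (hij : i ≠ j) {a : K} (ha : a ≠ 0) (hmem : elem hij a ∈ Set.range f) :
    IsDefSet f (Set.range (elem hij) : Set (Matrix.GeneralLinearGroup (Fin n) K)) := by
  have h : IsDef f fun v : Unit → Matrix.GeneralLinearGroup (Fin n) K =>
      v () = 1 ∨ ∃ t, t ∈ ((diag (ι := Fin n) (K := K)).range : Set _) ∧
        t * elem hij a * t⁻¹ = v () :=
    (IsDef.eq (IsWord.var _) IsWord.one).or (IsDef.ex ((hT.mem (IsWord.var _)).and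
      (IsDef.eq (((IsWord.var _).mul (IsWord.of_mem hmem)).mul (IsWord.var _).inv)
        (IsWord.var _))))
  refine h.congr fun v => Iff.symm ?_
  constructor
  · rintro ⟨b, hb⟩
    by_cases hb0 : b = 0
    · exact Or.inl (by rw [← hb, hb0, elem_zero])
    · rw [← hb]
      exact Or.inr (exists_diag_conj_elem hij ha hb0)
  · rintro (h | ⟨_, ⟨w, rfl⟩, h⟩)
    · exact ⟨0, by rw [elem_zero, h]⟩
    · exact ⟨_, by rw [← h, diag_conj_elem]⟩

/-- An elementary map to `GLₙ(K)` for which the diagonal torus is definable and whose range contains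
the elementary matrices `1 + Eᵢⱼ`. -/
structure IsFramed (f : H → Matrix.GeneralLinearGroup (Fin n) K) : Prop where
  isElementary : IsElementary f
  isDefSet_diag : IsDefSet f ((diag (ι := Fin n) (K := K)).range : Set _)
  elem_one_mem : ∀ {i j : Fin n} (hij : i ≠ j), elem hij 1 ∈ Set.range f

/-- An element that is the unique solution of a condition definable over the image lies in the
image. -/
theorem IsElementary.elem_one_mem_of_commutator (hf : IsElementary f)
    {S : Set (Matrix.GeneralLinearGroup (Fin n) K)} (hS : IsDefSet f S)
    {a b x : Matrix.GeneralLinearGroup (Fin n) K} (ha : a ∈ Set.range f) (hb : b ∈ Set.range f)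
    (hx : x ∈ S) (hxa : ⁅a, x⁆ = b) (huniq : ∀ y ∈ S, ⁅a, y⁆ = b → y = x) : x ∈ Set.range f := by
  obtain ⟨h, hh, hh'⟩ := hf.exists_mem (S := {y | y ∈ S ∧ ⁅a, y⁆ = b})
    ((hS.mem (IsWord.var _)).and
      (IsDef.eq ((IsWord.of_mem ha).commutator (IsWord.var _)) (IsWord.of_mem hb))) ⟨x, hx, hxa⟩
  exact ⟨h, huniq _ hh hh'⟩

theorem IsElementary.inv_mem_range (hf : IsElementary f)
    {x : Matrix.GeneralLinearGroup (Fin n) K} (hx : x ∈ Set.range f) : x⁻¹ ∈ Set.range f := by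
  obtain ⟨h, rfl⟩ := hx
  exact ⟨h⁻¹, hf.map_inv h⟩

theorem IsElementary.exists_isFramed [IsAlgClosed K] [CharZero K] (hn : 3 ≤ n)
    (hf : IsElementary f) : ∃ g, IsFramed fun h => g * f h * g⁻¹ := by
  have : NeZero n := ⟨by omega⟩
  obtain ⟨h₀, hh₀⟩ := hf.exists_mem (isDefSet_shiftElements (NeZero.ne n))
    shiftElements_nonempty
  obtain ⟨q, d, hd, hqd⟩ := exists_conj_eq_diag_of_mem_shiftElements hh₀
  have hf₁ : IsElementary fun h => q * f h * q⁻¹ := hf.comp_mulEquiv (MulAut.conj q)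
  have hT₁ := isDefSet_range_diag (f := fun h => q * f h * q⁻¹) hd ⟨h₀, hqd⟩
  have h₁ : ∀ j, ∃ a : Kˣ, ∀ hj : 0 ≠ j, elem hj (a : K) ∈ Set.range fun h => q * f h * q⁻¹ := by
    intro j
    by_cases hj : 0 = j
    · exact ⟨1, fun h => absurd hj h⟩
    · obtain ⟨a, ha, hmem⟩ := hf₁.exists_elem_mem_range hT₁ hj
      exact ⟨Units.mk0 a ha, fun _ => hmem⟩
  choose a ha using h₁
  -- Conjugation by `diag w` multiplies the (0, j) coefficient by w₀wⱼ⁻¹ = aⱼ⁻¹, turning it into 1.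
  let w : Fin n → Kˣ := Function.update a 0 1
  have hf₂ : IsElementary fun h => diag w * q * f h * (diag w * q)⁻¹ :=
    hf.comp_mulEquiv (MulAut.conj (diag w * q))
  have hmem : ∀ h, diag w * q * f h * (diag w * q)⁻¹ =
      diag w * (q * f h * q⁻¹) * (diag w)⁻¹ := fun h => by group
  have hT := isDefSet_range_diag (f := fun h => diag w * q * f h * (diag w * q)⁻¹) hd ⟨h₀, by
    simp only [hmem]
    rw [hqd, ← _root_.map_mul, ← _root_.map_inv, ← _root_.map_mul, mul_comm w, mul_inv_cancel_right]⟩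
  have hX : ∀ {i j : Fin n} (hij : i ≠ j),
      IsDefSet (fun h => diag w * q * f h * (diag w * q)⁻¹) (Set.range (elem (K := K) hij)) := by
    intro i j hij
    obtain ⟨b, hb, hb'⟩ := hf₂.exists_elem_mem_range hT hij
    exact isDefSet_range_elem hT hij hb hb'
  have hone : ∀ {j : Fin n} (hj : 0 ≠ j),
      elem hj (1 : K) ∈ Set.range fun h => diag w * q * f h * (diag w * q)⁻¹ := by
    intro j hj
    obtain ⟨h, hh⟩ := ha j hj
    refine ⟨h, ?_⟩
    simp only [hmem] at hh ⊢
    rw [hh, diag_conj_elem]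
    simp [w, Function.update_of_ne hj.symm]
  have htwo : ∀ {i j : Fin n} (hij : i ≠ j), 0 ≠ i → 0 ≠ j →
      elem hij (1 : K) ∈ Set.range fun h => diag w * q * f h * (diag w * q)⁻¹ := by
    intro i j hij hi hj
    refine hf₂.elem_one_mem_of_commutator (hX hij) (hone hi) (hone hj) ⟨1, rfl⟩
      (by rw [commutator_elem hi hij hj, mul_one]) ?_
    rintro _ ⟨b, rfl⟩ hb
    rw [commutator_elem hi hij hj, one_mul] at hb
    rw [elem_injective hj hb]
  refine ⟨diag w * q, hf₂, hT, ?_⟩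
  intro i j hij
  by_cases hi : 0 = i
  · subst hi
    exact hone hij
  by_cases hj : 0 = j
  · subst hj
    -- The (i, 0) element is pinned down by its commutator with the (0, k) element, which lies in
    -- the (i, k) root subgroup treated before.
    obtain ⟨k, hk, hk'⟩ := Fin.exists_ne_ne hn 0 i
    refine hf₂.elem_one_mem_of_commutator (hX hij) (hone hk.symm)
      (hf₂.inv_mem_range (htwo hk'.symm hi hk.symm)) ⟨1, rfl⟩ ?_ ?_
    · rw [← commutatorElement_inv, commutator_elem hij hk.symm hk'.symm, mul_one]
    · rintro _ ⟨b, rfl⟩ hb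
      rw [← commutatorElement_inv, commutator_elem hij hk.symm hk'.symm, mul_one, inv_inj] at hb
      rw [elem_injective hk'.symm hb]
  · exact htwo hij hi hj

end Frame

/-! ### The coefficient field of a framed map and the structure of its range. -/

namespace IsFramed

variable {n : ℕ} {K H : Type*} [Field K] [Group H] {f : H → Matrix.GeneralLinearGroup (Fin n) K}

/-- The range of a framed map, as a subgroup. -/
abbrev range (hf : IsFramed f) : Subgroup (Matrix.GeneralLinearGroup (Fin n) K) :=
  hf.isElementary.hom.range

theorem isDefSet_elem (hf : IsFramed f) {i j : Fin n} (hij : i ≠ j) :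
    IsDefSet f (Set.range (elem hij) : Set (Matrix.GeneralLinearGroup (Fin n) K)) :=
  isDefSet_range_elem hf.isDefSet_diag hij one_ne_zero (hf.elem_one_mem hij)

theorem commutator_mem (hf : IsFramed f) {x y : Matrix.GeneralLinearGroup (Fin n) K}
    (hx : x ∈ hf.range) (hy : y ∈ hf.range) : ⁅x, y⁆ ∈ hf.range := by
  rw [commutatorElement_def]
  exact mul_mem (mul_mem (mul_mem hx hy) (inv_mem hx)) (inv_mem hy)

theorem elem_mem_of_elem_mem (hf : IsFramed f) (hn : 3 ≤ n) {i j k l : Fin n} (hij : i ≠ j)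
    (hkl : k ≠ l) {a : K} (h : elem hij a ∈ hf.range) : elem hkl a ∈ hf.range := by
  have hr : ∀ {i j m : Fin n} (hij : i ≠ j) (him : i ≠ m), elem hij a ∈ hf.range →
      elem him a ∈ hf.range := by
    intro i j m hij him h
    by_cases hjm : j = m
    · subst hjm
      exact h
    · rw [← mul_one a, ← commutator_elem hij hjm him]
      exact hf.commutator_mem h (hf.elem_one_mem hjm)
  have hl : ∀ {i j m : Fin n} (hij : i ≠ j) (hmj : m ≠ j), elem hij a ∈ hf.range →
      elem hmj a ∈ hf.range := by
    intro i j m hij hmj h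
    by_cases him : m = i
    · subst him
      exact h
    · rw [← one_mul a, ← commutator_elem him hij hmj]
      exact hf.commutator_mem (hf.elem_one_mem him) h
  obtain ⟨m, hmi, hmk⟩ := Fin.exists_ne_ne hn i k
  -- The coefficient travels (i, j) → (i, m) → (k, m) → (k, l).
  exact hr hmk.symm hkl (hl hmi.symm hmk.symm (hr hij hmi.symm h))

/-- The field of those `a` for which the elementary matrices `1 + a Eᵢⱼ` lie in the range of a
framed map. -/
def coeffs (hf : IsFramed f) (hn : 3 ≤ n) : Subfield K where
  carrier := {a | ∀ (i j : Fin n) (hij : i ≠ j), elem hij a ∈ hf.range}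
  zero_mem' _ _ hij := by
    rw [elem_zero]
    exact one_mem _
  one_mem' _ _ hij := hf.elem_one_mem hij
  add_mem' ha hb _ _ hij := by
    rw [← elem_mul]
    exact mul_mem (ha _ _ hij) (hb _ _ hij)
  neg_mem' ha _ _ hij := by
    rw [← elem_inv]
    exact inv_mem (ha _ _ hij)
  mul_mem' ha hb i k hik := by
    obtain ⟨j, hji, hjk⟩ := Fin.exists_ne_ne hn i k
    rw [← commutator_elem hji.symm hjk hik]
    exact hf.commutator_mem (ha _ _ _) (hb _ _ _)
  inv_mem' a ha := by
    intro i k hik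
    by_cases ha0 : a = 0
    · rw [ha0, inv_zero, elem_zero]
      exact one_mem _
    obtain ⟨j, hji, hjk⟩ := Fin.exists_ne_ne hn i k
    -- The inverse is obtained as the solution of the commutator equation expressing b·a = 1.
    obtain ⟨h, ⟨b, hb⟩, hb'⟩ := hf.isElementary.exists_mem
      (S := {x | x ∈ Set.range (elem hji.symm) ∧ ⁅x, elem hjk a⁆ = elem hik 1})
      (((hf.isDefSet_elem hji.symm).mem (IsWord.var _)).and
        (IsDef.eq ((IsWord.var _).commutator (IsWord.of_mem (ha _ _ hjk)))
          (IsWord.of_mem (hf.elem_one_mem hik))))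
      ⟨elem hji.symm a⁻¹, ⟨_, rfl⟩, by
        rw [commutator_elem hji.symm hjk hik, inv_mul_cancel₀ ha0]⟩
    rw [← hb, commutator_elem hji.symm hjk hik] at hb'
    rw [← eq_inv_of_mul_eq_one_left (elem_injective hik hb')]
    exact hf.elem_mem_of_elem_mem hn _ hik ⟨h, hb.symm⟩

theorem mem_coeffs (hf : IsFramed f) (hn : 3 ≤ n) {i j : Fin n} (hij : i ≠ j) {a : K} :
    a ∈ hf.coeffs hn ↔ elem hij a ∈ hf.range :=
  ⟨fun h => h _ _ hij, fun h _ _ hkl => hf.elem_mem_of_elem_mem hn hij hkl h⟩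

/-- Field arithmetic on one root subgroup is given by group words, so polynomial equations become
definable. -/
theorem exists_isWord_aeval (hf : IsFramed f) (hn : 3 ≤ n) {i j : Fin n} (hij : i ≠ j)
    (p : Polynomial (hf.coeffs hn)) :
    ∃ w : (Unit → Matrix.GeneralLinearGroup (Fin n) K) → Matrix.GeneralLinearGroup (Fin n) K,
      IsWord f w ∧ ∀ b, w (fun _ => elem hij b) = elem hij (Polynomial.aeval b p) := by
  obtain ⟨k, hki, hkj⟩ := Fin.exists_ne_ne hn i j
  induction p using Polynomial.induction_on with
  | C a =>
    refine ⟨fun _ => elem hij a, IsWord.of_mem (a.2 _ _ hij), fun b => ?_⟩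
    rw [Polynomial.aeval_C]
    rfl
  | add p q hp hq =>
    obtain ⟨w₁, hw₁, h₁⟩ := hp
    obtain ⟨w₂, hw₂, h₂⟩ := hq
    exact ⟨_, hw₁.mul hw₂, fun b => by rw [h₁, h₂, elem_mul, map_add]⟩
  | monomial m a hp =>
    obtain ⟨w, hw, h⟩ := hp
    -- The inner commutators move `b` from position (i, j) through (i, k) to (j, k); the outer ones
    -- multiply and return to (i, j).
    refine ⟨fun v => ⁅⁅w v, ⁅elem hij.symm (1 : K), ⁅v (), elem hkj.symm (1 : K)⁆⁆⁆, elem hkj 1⁆,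
      (hw.commutator ((IsWord.of_mem (hf.elem_one_mem _)).commutator ((IsWord.var _).commutator
        (IsWord.of_mem (hf.elem_one_mem _))))).commutator (IsWord.of_mem (hf.elem_one_mem _)),
      fun b => ?_⟩
    beta_reduce
    rw [h, commutator_elem hij hkj.symm hki.symm, commutator_elem hij.symm hki.symm hkj.symm,
      commutator_elem hij hkj.symm hki.symm, commutator_elem hki.symm hkj hij]
    congr 1
    simp only [map_mul, map_pow, Polynomial.aeval_C, Polynomial.aeval_X]
    ring

theorem isAlgClosed_coeffs [IsAlgClosed K] (hf : IsFramed f) (hn : 3 ≤ n) :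
    IsAlgClosed (hf.coeffs hn) := by
  refine IsAlgClosed.of_exists_root _ fun p _ hp => ?_
  obtain ⟨b, hb⟩ := IsAlgClosed.exists_aeval_eq_zero K p hp.degree_pos.ne'
  have : NeZero n := ⟨by omega⟩
  obtain ⟨j, hj, -⟩ := Fin.exists_ne_ne hn 0 0
  obtain ⟨w, hw, h⟩ := hf.exists_isWord_aeval hn hj p
  obtain ⟨g, ⟨c, hc⟩, hg⟩ := hf.isElementary.exists_mem
    (S := {x | x ∈ Set.range (elem hj) ∧ w (fun _ => x) = 1})
    (((hf.isDefSet_elem hj).mem (IsWord.var _)).and (IsDef.eq hw IsWord.one))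
    ⟨elem hj b, ⟨b, rfl⟩, by rw [h, hb, elem_zero]⟩
  rw [← hc, h, elem_eq_one] at hg
  let x : hf.coeffs hn := ⟨c, (hf.mem_coeffs hn hj).2 ⟨g, hc.symm⟩⟩
  refine ⟨x, (algebraMap (hf.coeffs hn) K).injective ?_⟩
  rw [map_zero, ← Polynomial.aeval_algebraMap_apply_eq_algebraMap_eval]
  exact hg

/-- The inclusion of `SLₙ(L)` into `GLₙ(K)`, where `L` is the field of coefficients of a framed
map. -/
def slHom (hf : IsFramed f) (hn : 3 ≤ n) :
    Matrix.SpecialLinearGroup (Fin n) (hf.coeffs hn) →* Matrix.GeneralLinearGroup (Fin n) K :=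
  Matrix.SpecialLinearGroup.toGL.comp (Matrix.SpecialLinearGroup.map (hf.coeffs hn).subtype)

theorem slHom_injective (hf : IsFramed f) (hn : 3 ≤ n) : Function.Injective (hf.slHom hn) := by
  intro x y hxy
  ext i j
  exact congrArg (fun M : Matrix.GeneralLinearGroup (Fin n) K => M.1 i j) hxy

theorem slHom_transvection (hf : IsFramed f) (hn : 3 ≤ n) {i j : Fin n} (hij : i ≠ j)
    (a : hf.coeffs hn) :
    hf.slHom hn (Matrix.SpecialLinearGroup.transvection hij a) = elem hij (a : K) := by
  ext k l
  change ((Matrix.SpecialLinearGroup.transvection hij a).1 k l : K) = _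
  rw [Matrix.SpecialLinearGroup.transvection_coe, coe_elem, Matrix.add_apply, Matrix.add_apply,
    Matrix.single_apply, Matrix.single_apply, Matrix.one_apply, Matrix.one_apply]
  split_ifs <;> simp

theorem range_slHom_le (hf : IsFramed f) (hn : 3 ≤ n) : (hf.slHom hn).range ≤ hf.range := by
  have : Nontrivial (Fin n) := Fin.nontrivial_iff_two_le.2 (by omega)
  have h := Matrix.SpecialLinearGroup.eq_top_of_transvection_mem
    (hf.range.comap (hf.slHom hn)) fun i j hij a => by
      rw [Subgroup.mem_comap, slHom_transvection]
      exact a.2 _ _ hij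
  rintro _ ⟨x, rfl⟩
  exact (h ▸ Subgroup.mem_top x : x ∈ hf.range.comap (hf.slHom hn))

/-- Conjugating 1 + Eᵢ₀ shows that the ratios wᵢ/w₀ lie in the coefficient field; an `n`-th root
there of their product corrects the determinant to 1. -/
theorem diag_mem (hf : IsFramed f) (hn : 3 ≤ n) [IsAlgClosed K] {w : Fin n → Kˣ}
    (hw : diag w ∈ hf.range) :
    diag w ∈ (hf.slHom hn).range ⊔ Subgroup.center (Matrix.GeneralLinearGroup (Fin n) K) := by
  have := hf.isAlgClosed_coeffs hn
  have : NeZero n := ⟨by omega⟩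
  have hmem : ∀ i, (w i : K) * (w 0 : K)⁻¹ ∈ hf.coeffs hn := by
    intro i
    by_cases hi : i = 0
    · rw [hi, mul_inv_cancel₀ (w 0).ne_zero]
      exact one_mem _
    · rw [hf.mem_coeffs hn hi, ← mul_one (w i : K), ← diag_conj_elem]
      exact mul_mem (mul_mem hw (hf.elem_one_mem hi)) (inv_mem hw)
  let a : Fin n → hf.coeffs hn := fun i => ⟨_, hmem i⟩
  have ha : ∀ i, a i ≠ 0 := fun i hi =>
    mul_ne_zero (w i).ne_zero (inv_ne_zero (w 0).ne_zero) (congrArg Subtype.val hi)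
  obtain ⟨c, hc⟩ := IsAlgClosed.exists_pow_nat_eq (∏ i, a i) (Nat.pos_of_ne_zero (NeZero.ne n))
  have hp : ∏ i, a i ≠ 0 := Finset.prod_ne_zero_iff.2 fun i _ => ha i
  have hc0 : c ≠ 0 := by
    rintro rfl
    rw [zero_pow (NeZero.ne n)] at hc
    exact hp hc.symm
  have hc0' : (c : K) ≠ 0 := fun h => hc0 (Subtype.ext h)
  let x : Matrix.SpecialLinearGroup (Fin n) (hf.coeffs hn) :=
    ⟨Matrix.diagonal fun i => a i * c⁻¹, by
      rw [Matrix.det_diagonal, Finset.prod_mul_distrib, Finset.prod_const, Finset.card_univ,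
        Fintype.card_fin, ← hc, inv_pow, mul_inv_cancel₀ (hc ▸ hp)]⟩
  have hx : diag w = hf.slHom hn x * scalar (Fin n) (Units.mk0 (c : K) hc0' * w 0) := by
    ext i j
    have h₁ : (scalar (Fin n) (Units.mk0 (c : K) hc0' * w 0)).1 =
      Matrix.diagonal fun _ => (c : K) * w 0 := rfl
    rw [Units.val_mul, h₁, Matrix.mul_diagonal, coe_diag]
    change _ = ((Matrix.diagonal fun i => a i * c⁻¹) i j : K) * _
    rw [Matrix.diagonal_apply, Matrix.diagonal_apply]
    split_ifs with h
    · change (w i : K) = (w i * (w 0 : K)⁻¹ * (c : K)⁻¹) * (c * w 0)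
      field_simp
    · simp
  rw [hx]
  refine Subgroup.mul_mem_sup ⟨x, rfl⟩ ?_
  rw [center_eq_range_scalar]
  exact ⟨_, rfl⟩

/-- The elements lying in a definable set all of whose points in the range of `f` lie in `Γ`. -/
def definablyIn (hf : IsFramed f) (Γ : Subgroup (Matrix.GeneralLinearGroup (Fin n) K)) :
    Subgroup (Matrix.GeneralLinearGroup (Fin n) K) where
  carrier := {g | ∃ S, IsDefSet f S ∧ g ∈ S ∧ ∀ h, f h ∈ S → f h ∈ Γ}
  one_mem' := ⟨{1}, IsDef.eq (IsWord.var _) IsWord.one, rfl, fun h hh => by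
    rw [Set.mem_singleton_iff.1 hh]
    exact one_mem _⟩
  mul_mem' := by
    rintro x y ⟨S, hS, hx, hS'⟩ ⟨T, hT, hy, hT'⟩
    refine ⟨_, hS.mul hT, ⟨x, hx, by simpa using hy⟩, ?_⟩
    rintro h ⟨s, hs, hs'⟩
    -- The given factors need not be in the image; Tarski–Vaught replaces them by `f a` and `f (a⁻¹
    -- * h)`.
    obtain ⟨a, ha, ha'⟩ := hf.isElementary.exists_mem_of_mem_mul (h := h) hS hT hs hs' (by simp)
    have h₁ : f (a⁻¹ * h) = (f a)⁻¹ * f h := by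
      rw [hf.isElementary.map_mul, hf.isElementary.map_inv]
    have h₂ := mul_mem (hS' _ ha) (hT' (a⁻¹ * h) (h₁ ▸ ha'))
    rwa [← hf.isElementary.map_mul, mul_inv_cancel_left] at h₂
  inv_mem' := by
    rintro x ⟨S, hS, hx, hS'⟩
    refine ⟨{y | y⁻¹ ∈ S}, hS.mem (IsWord.var _).inv, by simpa using hx, fun h hh => ?_⟩
    rw [Set.mem_ofPred_eq, ← hf.isElementary.map_inv] at hh
    simpa [hf.isElementary.map_inv] using hS' _ hh

/-- The torus and the root subgroups lie in `definablyIn Γ` and generate GLₙ(K). For an image point,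
membership in `definablyIn Γ` means membership in `Γ`. -/
theorem range_le [IsAlgClosed K] (hf : IsFramed f) (hn : 3 ≤ n) (h : H) :
    f h ∈ (hf.slHom hn).range ⊔ Subgroup.center (Matrix.GeneralLinearGroup (Fin n) K) := by
  have : Nontrivial (Fin n) := Fin.nontrivial_iff_two_le.2 (by omega)
  set Γ := (hf.slHom hn).range ⊔ Subgroup.center (Matrix.GeneralLinearGroup (Fin n) K)
  have hdiag : ∀ w, diag w ∈ hf.definablyIn Γ := fun w =>
    ⟨_, hf.isDefSet_diag, ⟨w, rfl⟩, by
      rintro h ⟨w', hw'⟩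
      rw [← hw']
      exact hf.diag_mem hn ⟨h, hw'.symm⟩⟩
  have helem : ∀ {i j : Fin n} (hij : i ≠ j) (a : K), elem hij a ∈ hf.definablyIn Γ :=
    fun hij a => ⟨_, hf.isDefSet_elem hij, ⟨a, rfl⟩, by
      rintro h ⟨b, hb⟩
      rw [← hb]
      refine Subgroup.mem_sup_left ⟨_, hf.slHom_transvection hn hij ⟨b, ?_⟩⟩
      exact (hf.mem_coeffs hn hij).2 ⟨h, hb.symm⟩⟩
  have hSL := Matrix.SpecialLinearGroup.eq_top_of_transvection_mem
    ((hf.definablyIn Γ).comap Matrix.SpecialLinearGroup.toGL) fun i j hij a => helem hij a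
  have hall : ∀ g, g ∈ hf.definablyIn Γ := by
    intro g
    obtain ⟨x, c, rfl⟩ := exists_eq_toGL_mul_scalar (by omega) g
    exact mul_mem (hSL ▸ Subgroup.mem_top x :
      x ∈ (hf.definablyIn Γ).comap Matrix.SpecialLinearGroup.toGL) (hdiag fun _ => c)
  obtain ⟨S, -, hS, hS'⟩ := hall (f h)
  exact hS' h hS

theorem isSLCentral [IsAlgClosed K] (hf : IsFramed f) (hn : 3 ≤ n) :
    IsSLCentral n (hf.coeffs hn) H := by
  let s : Matrix.SpecialLinearGroup (Fin n) (hf.coeffs hn) →* H :=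
    (MonoidHom.ofInjective (f := hf.isElementary.hom) hf.isElementary.injective).symm.toMonoidHom.comp
      ((hf.slHom hn).codRestrict hf.range fun x => hf.range_slHom_le hn ⟨x, rfl⟩)
  have hs : ∀ x, f (s x) = hf.slHom hn x := fun x =>
    congrArg Subtype.val ((MonoidHom.ofInjective
      (f := hf.isElementary.hom) hf.isElementary.injective).apply_symm_apply _)
  refine ⟨s, fun x y hxy => hf.slHom_injective hn (by rw [← hs, hxy, hs]), fun h => ?_⟩
  obtain ⟨_, ⟨x, rfl⟩, z, hz, hxz⟩ := Subgroup.mem_sup_of_normal_right.1 (hf.range_le hn h)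
  refine ⟨x, (s x)⁻¹ * h, hf.isElementary.mem_center_iff.1 ?_, (mul_inv_cancel_left _ _).symm⟩
  rw [hf.isElementary.map_mul, hf.isElementary.map_inv, hs, ← hxz, inv_mul_cancel_left]
  exact hz

end IsFramed

/-! ### Universe adjustment and the conclusion. -/

theorem RingEquiv.isAlgClosed {K L : Type*} [Field K] [Field L] [IsAlgClosed K] (e : K ≃+* L) :
    IsAlgClosed L := by
  refine IsAlgClosed.of_exists_root _ fun p _ hp => ?_
  obtain ⟨x, hx⟩ := IsAlgClosed.exists_eval₂_eq_zero e.symm.toRingHom p hp.degree_pos.ne'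
  refine ⟨e x, e.symm.injective ?_⟩
  rw [map_zero, ← hx, ← e.symm_apply_apply x, e.apply_symm_apply]
  exact (Polynomial.eval₂_at_apply e.symm.toRingHom (e x)).symm

/-- A root subgroup injects `L` into `H`, so the coefficient field can be moved to the universe of
`H`. -/
theorem IsSLCentral.small {n : ℕ} (hn : 3 ≤ n) {L : Type u} [Field L] {H : Type v} [Group H]
    (h : IsSLCentral n L H) : Small.{v} L := by
  obtain ⟨s, hinj, -⟩ := h
  have : NeZero n := ⟨by omega⟩
  obtain ⟨j, hj, -⟩ := Fin.exists_ne_ne hn 0 0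
  refine small_of_injective (f := fun a => s (Matrix.SpecialLinearGroup.transvection hj a)) ?_
  intro a b hab
  exact elem_injective hj (congrArg Matrix.SpecialLinearGroup.toGL (hinj hab))

theorem GroupElemEquiv.exists_isSLCentral {F : Type u} [Field F] [IsAlgClosed F] [CharZero F]
    {n : ℕ} (hn : 3 ≤ n) {H : Type v} [Group H]
    (h : GroupElemEquiv H (Matrix.GeneralLinearGroup (Fin n) F)) :
    ∃ (L : Type v) (_ : Field L), IsAlgClosed L ∧ CharZero L ∧ IsSLCentral n L H ∧
      IsUnitsLike (Subgroup.center H) := by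
  have : NeZero n := ⟨by omega⟩
  obtain ⟨I, U, f₀, hf₀⟩ := h.exists_isElementary
  obtain ⟨e⟩ := nonempty_germ_generalLinearGroup_mulEquiv (n := Fin n) (F := F) (U := U)
  have hf := hf₀.comp_mulEquiv e
  obtain ⟨g, hg⟩ := hf.exists_isFramed hn
  have hL := hg.isSLCentral hn
  have := hg.isAlgClosed_coeffs hn
  have := hL.small hn
  let r : hg.coeffs hn ≃+* Shrink.{v} (hg.coeffs hn) := (Shrink.ringEquiv _).symm
  exact ⟨Shrink.{v} (hg.coeffs hn), inferInstance, r.isAlgClosed,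
    charZero_of_injective_ringHom (f := r.toRingHom) r.injective, hL.of_ringEquiv r,
    IsUnitsLike.center_of_isElementary hf (IsUnitsLike.center_generalLinearGroup n _)⟩

theorem mainTheorem11 {F : Type u} [Field F] [IsAlgClosed F] [CharZero F] (n : ℕ) (hn : 3 ≤ n)
    (H : Type v) [Group H] :
    (GroupElemEquiv H (Matrix.GeneralLinearGroup (Fin n) F) ↔
      Nonempty (H ≃* (commutator H × Subgroup.center H) ⧸ (derivedCenterHom H).ker) ∧
      (∃ (L : Type v) (_ : Field L), FieldElemEquiv L F ∧
        Nonempty (commutator H ≃* Matrix.SpecialLinearGroup (Fin n) L)) ∧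
      GroupElemEquiv (Subgroup.center H) ℂˣ) ∧
    (GroupElemEquiv H (Matrix.GeneralLinearGroup (Fin n) F) →
      IsCentralIsogeny (derivedCenterHom H) ∧
      Nonempty ((derivedCenterHom H).ker ≃* rootsOfUnity n ℂ)) := by
  -- The structural condition through which both conditions are compared.
  have key : GroupElemEquiv H (Matrix.GeneralLinearGroup (Fin n) F) ↔
      ∃ (L : Type v) (_ : Field L), IsAlgClosed L ∧ CharZero L ∧ IsSLCentral n L H ∧
        IsUnitsLike (Subgroup.center H) :=
    ⟨fun h => h.exists_isSLCentral hn, fun ⟨_, _, _, _, hL, hZ⟩ => hL.groupElemEquiv (by omega) hZ⟩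
  refine ⟨key.trans ⟨?_, ?_⟩, fun h => ?_⟩
  · rintro ⟨L, _, _, _, hL, hZ⟩
    refine ⟨⟨(QuotientGroup.quotientKerEquivOfSurjective _
      (hL.surjective_derivedCenterHom hn)).symm⟩,
      ⟨L, _, fieldElemEquiv_of_isAlgClosed, hL.nonempty_commutator_mulEquiv hn⟩, ?_⟩
    exact hZ.groupElemEquiv
  · rintro ⟨⟨β⟩, ⟨L, _, hLF, ⟨e⟩⟩, hZ⟩
    obtain ⟨_, _⟩ := hLF.model_ACF
    exact ⟨L, _, inferInstance, inferInstance, isSLCentral_of_mulEquiv hn β e, hZ.isUnitsLike⟩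
  · obtain ⟨L, _, _, _, hL, -⟩ := key.1 h
    exact ⟨hL.isCentralIsogeny hn, hL.nonempty_ker_mulEquiv hn⟩
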